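/- Let $0<m<n$ be integers and let $F=(f_1,\dots,f_m):\mathbb{R}^n\to\mathbb{R}^m$ be a centered stationary Gaussian random field on a probability space $(\Omega,\mathfrak{S},\mathcal{P})$ with the following two properties: almost surely the sample path of $F$ is of class $C^{3-}=\bigcap_{0<\beta<1}C^{2+\beta}$ (locally on $\mathbb{R}^n$); and the joint distribution of $(F(0),\nabla F(0))$ is non-degenerate, i.e. there is $k_1>0$ with $$\mathcal{E}\Big(\Big|\sum_{i=1}^m\eta_i f_i(0)+\sum_{i=1}^m\sum_{j=1}^n\xi_{ij}\,\partial_jf_i(0)\Big|^2\Big)\ge k_1\quad\text{whenever}\quad\sum_i\eta_i^2+\sum_{i,j}\xi_{ij}^2=1 .$$ Put $k_{i_1i_2}(x)=\mathcal{E}\big(f_{i_1}(x)f_{i_2}(0)\big)$ for $x\in\mathbb{R}^n$ and $1\le i_1,i_2\le m$. Equip $C^1(\mathbb{R}^n,\mathbb{R}^m)$ with the topology of locally uniform convergence of maps and their first derivatives, and let $$C^1_*(\mathbb{R}^n,\mathbb{R}^m)=\{G\in C^1(\mathbb{R}^n,\mathbb{R}^m): \nabla G(x)\text{ has full rank at every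 }x\text{ with }G(x)=0\},$$ with its Borel $\sigma$-algebra $\mathfrak{B}$. Let $\gamma_F$ be the law of $F$, as a measure on $C^1_*(\mathbb{R}^n,\mathbb{R}^m)$. Let $\mathbb{R}^n$ act on $C^1_*(\mathbb{R}^n,\mathbb{R}^m)$ by $(\tau_vG)(x)=G(x+v)$. Let $B_R$ be the open ball of radius $R$ centered at $0$ in $\mathbb{R}^n$ and $|B_R|$ its volume. If $$\lim_{R\to\infty}\sum_{1\le i_1,i_2\le m}\frac1{|B_R|}\int_{B_R}k_{i_1i_2}(x)^2\,dx=0,$$ then the action of $\mathbb{R}^n$ on $(C^1_*(\mathbb{R}^n,\mathbb{R}^m),\mathfrak{B},\gamma_F)$ is ergodic: $\gamma_F$ is a probability measure on $C^1_*(\mathbb{R}^n,\mathbb{R}^m)$, it is preserved by every $\tau_v$, and every $A\in\mathfrak{B}$ with $\gamma_F\big((\tau_vA)\,\Delta\,A\big)=0$ for all $v\in\mathbb{R}^n$ satisfies $\gamma_F(A)=0$ or $\gamma_F(A)=1$. -/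

import Mathlib

open MeasureTheory ProbabilityTheory Filter Topology
open scoped NNReal

/-- The Euclidean space `ℝᵏ`. -/
abbrev Euc (k : ℕ) : Type := EuclideanSpace ℝ (Fin k)

/-- The space `C¹(ℝⁿ, ℝᵐ)` of continuously differentiable maps. -/
def C1Space (n m : ℕ) : Type := {G : Euc n → Euc m // ContDiff ℝ 1 G}

namespace C1Space

variable {n m : ℕ}

/-- An element of `C¹(ℝⁿ, ℝᵐ)` as a continuous map. -/
def toContinuousMap (G : C1Space n m) : C(Euc n, Euc m) :=
  ⟨G.1, G.2.continuous⟩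

/-- The derivative of an element of `C¹(ℝⁿ, ℝᵐ)` as a continuous map. -/
noncomputable def derivMap (G : C1Space n m) : C(Euc n, Euc n →L[ℝ] Euc m) :=
  ⟨fderiv ℝ G.1, G.2.continuous_fderiv one_ne_zero⟩

/-- The `C¹` topology: uniform convergence on compact sets of the map and of its derivative. -/
noncomputable instance instTopologicalSpace : TopologicalSpace (C1Space n m) :=
  TopologicalSpace.induced
    (fun G => (toContinuousMap G, derivMap G))
    (inferInstance : TopologicalSpace (C(Euc n, Euc m) × C(Euc n, Euc n →L[ℝ] Euc m)))

/-- The Borel σ-algebra of `C¹(ℝⁿ, ℝᵐ)`. -/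
noncomputable instance instMeasurableSpace : MeasurableSpace (C1Space n m) := borel _

instance instBorelSpace : BorelSpace (C1Space n m) := ⟨rfl⟩

/-- The zero map. -/
def zeroMap : C1Space n m := ⟨fun _ => 0, contDiff_const⟩

end C1Space

/-- `C¹_*(ℝⁿ, ℝᵐ)`: the maps whose derivative has full rank (`m < n`, so rank `m`) at every zero.
As a subtype it carries the subspace topology and the corresponding Borel σ-algebra. -/
def C1Star (n m : ℕ) : Set (C1Space n m) :=
  {G | ∀ x : Euc n, G.1 x = 0 → Function.Surjective (fderiv ℝ G.1 x)}

/-- The action of `ℝⁿ` on `C¹_*(ℝⁿ, ℝᵐ)` by shifts: `(v +ᵥ G) x = G (x + v)`. -/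
noncomputable instance C1Star.instAddAction (n m : ℕ) : AddAction (Euc n) (C1Star n m) where
  vadd v G := ⟨⟨fun x => G.1.1 (x + v), G.1.2.comp (contDiff_id.add contDiff_const)⟩, by
    intro x hx
    have h : fderiv ℝ (fun y => G.1.1 (y + v)) x = fderiv ℝ G.1.1 (x + v) :=
      fderiv_comp_add_right v
    change Function.Surjective (fderiv ℝ (fun y => G.1.1 (y + v)) x)
    rw [h]
    exact G.2 (x + v) hx⟩
  zero_vadd G := by
    apply Subtype.ext
    apply Subtype.ext
    funext x
    exact congrArg G.1.1 (add_zero x)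
  add_vadd v w G := by
    apply Subtype.ext
    apply Subtype.ext
    funext x
    change G.1.1 (x + (v + w)) = G.1.1 (x + v + w)
    rw [add_assoc]

/-- `C^{3-}` regularity, `⋂_{0 < β < 1} C^{2+β}`: twice continuously differentiable, with second
derivative `β`-Hölder on compact sets for every `β < 1`. -/
def IsC3Minus {n m : ℕ} (G : Euc n → Euc m) : Prop :=
  ContDiff ℝ 2 G ∧
    ∀ β : ℝ≥0, 0 < β → β < 1 → ∀ K : Set (Euc n), IsCompact K →
      ∃ C : ℝ≥0, HolderOnWith C β (iteratedFDeriv ℝ 2 G) K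

section RandomField

variable {Ω : Type*} [MeasurableSpace Ω] {n m : ℕ}

/-- A random field is stationary if its finite dimensional distributions are invariant under
translations. -/
def IsStationaryField (F : Euc n → Ω → Euc m) (P : Measure Ω) : Prop :=
  ∀ (k : ℕ) (x : Fin k → Euc n) (v : Euc n),
    P.map (fun ω (i : Fin k) => F (x i + v) ω) = P.map (fun ω (i : Fin k) => F (x i) ω)

/-- A random field is centered if every component has mean zero at every point. -/
def IsCenteredField (F : Euc n → Ω → Euc m) (P : Measure Ω) : Prop :=
  ∀ (x : Euc n) (i : Fin m), Integrable (fun ω => F x ω i) P ∧ ∫ ω, F x ω i ∂P = 0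

/-- The partial derivative `∂_j f_i (x)` of the sample path. -/
noncomputable def partialDerivField (F : Euc n → Ω → Euc m) (i : Fin m) (j : Fin n) (x : Euc n)
    (ω : Ω) : ℝ :=
  (fderiv ℝ (fun y => F y ω) x (EuclideanSpace.single j 1)) i

/-- The joint distribution of `(F(0), ∇F(0))` is non-degenerate: the variance of a unit linear
combination of the components of `F(0)` and `∇F(0)` is bounded below. -/
def IsNondegenerateAtZero (F : Euc n → Ω → Euc m) (P : Measure Ω) : Prop :=
  ∃ κ : ℝ, 0 < κ ∧ ∀ (η : Fin m → ℝ) (ξ : Fin m → Fin n → ℝ),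
    ∑ i, η i ^ 2 + ∑ i, ∑ j, ξ i j ^ 2 = 1 →
      κ ≤ ∫ ω, |∑ i, η i * F 0 ω i + ∑ i, ∑ j, ξ i j * partialDerivField F i j 0 ω| ^ 2 ∂P

/-- The covariance function `k_{i₁ i₂}(x) = 𝔼[f_{i₁}(x) f_{i₂}(0)]` of a stationary field. -/
noncomputable def covFun (F : Euc n → Ω → Euc m) (P : Measure Ω) (i₁ i₂ : Fin m) (x : Euc n) : ℝ :=
  ∫ ω, F x ω i₁ * F 0 ω i₂ ∂P

open Classical in
/-- The sample path of `F` as an element of `C¹(ℝⁿ, ℝᵐ)`; the (null) set of `ω` whose path is not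
`C¹` is sent to the zero map. -/
noncomputable def samplePath (F : Euc n → Ω → Euc m) (ω : Ω) : C1Space n m :=
  if h : ContDiff ℝ 1 (fun x => F x ω) then ⟨fun x => F x ω, h⟩ else C1Space.zeroMap

/-- The law of `F` on `C¹(ℝⁿ, ℝᵐ)`. -/
noncomputable def fieldLaw (F : Euc n → Ω → Euc m) (P : Measure Ω) : Measure (C1Space n m) :=
  P.map (samplePath F)

/-- The measure `γ_F`, i.e. the law of `F`, on the Borel subset `C¹_*(ℝⁿ, ℝᵐ)`. -/
noncomputable def fieldLawStar (F : Euc n → Ω → Euc m) (P : Measure Ω) : Measure (C1Star n m) :=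
  (fieldLaw F P).comap Subtype.val

end RandomField

/-! Two facts are needed: almost every path lies in `C1Star`, and the shifts act ergodically on the
resulting law.

The first is Bulinskaya's argument. A zero x at which the derivative is not onto yields a direction
u ≠ 0 with F(x) = 0 and ∇⟨u, F⟩(x) = 0. These are n + m scalar equations in only n + m - 1
parameters, since u matters up to scaling. Nondegeneracy at 0, carried to every point by
stationarity, gives a Gaussian bound on the characteristic function of these scalars, so they are
all within δ of 0 with probability O(δ^(n+m)) (`measureReal_norm_le_of_charFun_le`). A grid of mesh
1/N has O(N^(n+m-1)) points; for paths with a fixed Lipschitz bound the union bound leaves O(1/N)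
(`ae_forall_ne_zero_of_small_ball`).

For the second, finite measures on `C1Star` are determined by the integrals of the characters exp(i
∑ ⟨t x, G x⟩), and for a Gaussian field these integrals depend only on variances. Vanishing averages
of the squared covariances produce, for any finite set of offsets, one translation making all the
corresponding covariances small (`exists_forall_lt_of_tendsto_average_zero`). Hence there is a
proper filter of translations along which every covariance tends to 0, and along it each shifted
character converges weakly in L² to its mean. If A is invariant, the integral over A of a shifted
character does not depend on the shift, so it equals μ(A) times the mean; a proper filter is enough,
because the quantity is constant. Thus μ restricted to A is μ(A) • μ, and evaluating at A gives μ(A)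
= μ(A)². -/

/-! ### Borel structure of C¹ and C¹_*, and measurability of the sample path. -/

/-- Measurability into `C(X, Y)` with its Borel σ-algebra follows from that of the evaluations. -/
theorem ContinuousMap.measurable_borel_of_eval {Z X Y : Type*} [MeasurableSpace Z]
    [TopologicalSpace X] [SecondCountableTopology X] [LocallyCompactSpace X]
    [PseudoEMetricSpace Y] [SecondCountableTopology Y] [MeasurableSpace Y] [BorelSpace Y]
    {Φ : Z → C(X, Y)} (h : ∀ x, Measurable fun z => Φ z x) :
    @Measurable Z C(X, Y) _ (borel _) Φ := by
  rw [borel_eq_generateFrom_of_subbasis ContinuousMap.compactOpen_eq]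
  refine measurable_generateFrom ?_
  rintro _ ⟨K, hK, U, hU, rfl⟩
  obtain ⟨D, hDc, hDd⟩ := TopologicalSpace.exists_countable_dense K
  -- By compactness, K is mapped into the open set U exactly when the distance to the complement of
  -- U is bounded below on K. Such a lower bound is a closed condition, so it only has to be checked
  -- on the countable dense set D.
  have key : Φ ⁻¹' {f | Set.MapsTo f K U} = ⋃ N : ℕ, ⋂ x ∈ D,
      {z | ((N : ENNReal) + 1)⁻¹ ≤ Metric.infEDist (Φ z x) Uᶜ} := by
    ext z
    have hcont : Continuous fun x : K => Metric.infEDist (Φ z x) Uᶜ :=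
      Metric.continuous_infEDist.comp ((Φ z).continuous.comp continuous_subtype_val)
    simp only [Set.mem_preimage, Set.mem_ofPred_eq, Set.mem_iUnion, Set.mem_iInter]
    constructor
    · intro hz
      rcases K.eq_empty_or_nonempty with rfl | hne
      · exact ⟨0, fun x => x.2.elim⟩
      have : CompactSpace K := isCompact_iff_compactSpace.1 hK
      have : Nonempty K := hne.to_subtype
      obtain ⟨x₀, -, hx₀⟩ := isCompact_univ.exists_isMinOn Set.univ_nonempty hcont.continuousOn
      have hpos : Metric.infEDist (Φ z x₀) Uᶜ ≠ 0 := by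
        intro h0
        rw [← Metric.mem_closure_iff_infEDist_zero, hU.isClosed_compl.closure_eq] at h0
        exact h0 (hz x₀.2)
      obtain ⟨N, hN⟩ := ENNReal.exists_inv_nat_lt hpos
      refine ⟨N, fun x _ => le_trans (le_trans ?_ hN.le) (hx₀ (Set.mem_univ x))⟩
      exact ENNReal.inv_le_inv.2 le_self_add
    · rintro ⟨N, hN⟩ x hx
      have hclosed : IsClosed {x : K | ((N : ENNReal) + 1)⁻¹ ≤ Metric.infEDist (Φ z x) Uᶜ} :=
        isClosed_le continuous_const hcont
      have hall := hclosed.closure_subset_iff.2 (fun x hx => hN x hx : D ⊆ _) (hDd ⟨x, hx⟩)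
      by_contra hxU
      have h0 : Metric.infEDist (Φ z x) Uᶜ = 0 := Metric.infEDist_zero_of_mem hxU
      simp only [Set.mem_ofPred_eq, h0, nonpos_iff_eq_zero, ENNReal.inv_eq_zero] at hall
      simp at hall
  rw [key]
  refine MeasurableSet.iUnion fun N => MeasurableSet.biInter hDc fun x _ => ?_
  exact measurableSet_le measurable_const (measurable_infEDist.comp (h x))

namespace C1Space

variable {n m : ℕ}

theorem hasFDerivAt (G : C1Space n m) (x : Euc n) : HasFDerivAt G.1 (fderiv ℝ G.1 x) x :=
  (G.2.differentiable one_ne_zero x).hasFDerivAt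

end C1Space

namespace C1Space

variable {n m : ℕ} {Z : Type*} [MeasurableSpace Z]

theorem measurable_fderiv_apply {Φ : Z → C1Space n m} (h : ∀ x, Measurable fun z => (Φ z).1 x)
    (x v : Euc n) : Measurable fun z => fderiv ℝ (Φ z).1 x v := by
  refine measurable_of_tendsto_metrizable
    (f := fun (k : ℕ) z => (k : ℝ) • ((Φ z).1 (x + (k : ℝ)⁻¹ • v) - (Φ z).1 x))
    (fun k => ?_) ?_
  · exact ((h _).sub (h _)).const_smul (k : ℝ)
  · exact tendsto_pi_nhds.2 fun z =>
      (((Φ z).hasFDerivAt x).lim_real v).comp tendsto_natCast_atTop_atTop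

/-- The C¹ topology is induced from a product, so its Borel σ-algebra is a comap, and second
countability splits the product into its two factors. Evaluations of the derivative are limits of
difference quotients, assembled from finitely many columns. -/
theorem measurable_of_eval {Φ : Z → C1Space n m} (h : ∀ x, Measurable fun z => (Φ z).1 x) :
    Measurable Φ := by
  let _ : MeasurableSpace C(Euc n, Euc m) := borel _
  have : BorelSpace C(Euc n, Euc m) := ⟨rfl⟩
  let _ : MeasurableSpace C(Euc n, Euc n →L[ℝ] Euc m) := borel _
  have : BorelSpace C(Euc n, Euc n →L[ℝ] Euc m) := ⟨rfl⟩
  have hb : (instMeasurableSpace : MeasurableSpace (C1Space n m)) =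
      MeasurableSpace.comap (fun G => (toContinuousMap G, derivMap G)) inferInstance := by
    refine borel_comap.trans ?_
    rw [← BorelSpace.measurable_eq (α := C(Euc n, Euc m) × C(Euc n, Euc n →L[ℝ] Euc m))]
  rw [hb]
  refine measurable_comap_iff.2 (Measurable.prodMk ?_ ?_)
  · exact ContinuousMap.measurable_borel_of_eval h
  · refine ContinuousMap.measurable_borel_of_eval fun x => ?_
    have hrep : (fun z => derivMap (Φ z) x) = fun z =>
        ∑ j : Fin n, (ContinuousLinearMap.smulRightL ℝ (Euc n) (Euc m) (EuclideanSpace.proj j))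
          (fderiv ℝ (Φ z).1 x (EuclideanSpace.single j 1)) := by
      funext z
      ext1 v
      have hv : v = ∑ j, v j • EuclideanSpace.single j (1 : ℝ) := by
        simpa using ((EuclideanSpace.basisFun (Fin n) ℝ).sum_repr v).symm
      conv_lhs => rw [hv]
      simp [derivMap, map_sum]
    refine hrep ▸ Finset.measurable_sum _ fun j _ => ?_
    exact (ContinuousLinearMap.continuous _).measurable.comp (measurable_fderiv_apply h _ _)

theorem continuous_toContinuousMap : Continuous (toContinuousMap (n := n) (m := m)) :=
  continuous_fst.comp (continuous_induced_dom (f := fun G => (toContinuousMap G, derivMap G)))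

theorem continuous_derivMap : Continuous (derivMap (n := n) (m := m)) :=
  continuous_snd.comp (continuous_induced_dom (f := fun G => (toContinuousMap G, derivMap G)))

theorem measurable_eval (x : Euc n) : Measurable fun G : C1Space n m => G.1 x :=
  ((continuous_eval_const x).comp continuous_toContinuousMap).measurable

end C1Space

/-- A linear map into Euclidean space is surjective unless some unit vector is orthogonal to its
range. -/
theorem surjective_iff_forall_inner {n m : ℕ} (L : Euc n →L[ℝ] Euc m) :
    Function.Surjective L ↔ ∀ u : Euc m, ‖u‖ = 1 → ∃ v, inner ℝ u (L v) ≠ 0 := by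
  constructor
  · intro h u hu
    obtain ⟨v, hv⟩ := h u
    exact ⟨v, by rw [hv, real_inner_self_eq_norm_sq, hu]; norm_num⟩
  · intro h
    have hr : L.range = ⊤ := by
      by_contra hne
      have hne' : L.rangeᗮ ≠ ⊥ := fun h0 => hne ((Submodule.orthogonal_eq_bot_iff).1 h0)
      obtain ⟨w, hw, hw0⟩ := Submodule.exists_mem_ne_zero_of_ne_bot hne'
      obtain ⟨v, hv⟩ := h (‖w‖⁻¹ • w) (by rw [norm_smul, norm_inv, norm_norm]; field_simp)
      have h0 : inner ℝ w (L v) = 0 :=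
        Submodule.inner_left_of_mem_orthogonal (K := L.range) ⟨v, rfl⟩ hw
      simp [real_inner_smul_left, h0] at hv
    exact LinearMap.range_eq_top.1 hr

/-- Failure of full rank at a zero x, witnessed by a unit vector u, is a closed condition on (x, u,
G). With x in a closed ball and u in the sphere, projecting to G is a closed map, so the complement
is a countable union of closed sets. -/
theorem measurableSet_C1Star (n m : ℕ) : MeasurableSet (C1Star n m) := by
  have key : C1Star n m = (⋃ k : ℕ, Prod.snd '' {q : (Metric.closedBall (0 : Euc n) k ×
      Metric.sphere (0 : Euc m) 1) × C1Space n m | q.2.1 q.1.1 = 0 ∧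
        ∀ v, inner ℝ (q.1.2 : Euc m) (fderiv ℝ q.2.1 q.1.1 v) = 0})ᶜ := by
    ext G
    simp only [C1Star, Set.mem_ofPred_eq, Set.mem_compl_iff, Set.mem_iUnion, Set.mem_image,
      surjective_iff_forall_inner]
    constructor
    · rintro hG ⟨k, ⟨⟨⟨x, hx⟩, ⟨u, hu⟩⟩, G'⟩, ⟨h1, h2⟩, rfl⟩
      obtain ⟨v, hv⟩ := hG x h1 u (by simpa using hu)
      exact hv (h2 v)
    · intro hG x hx u hu
      by_contra! hv
      obtain ⟨k, hk⟩ := exists_nat_ge ‖x‖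
      exact hG ⟨k, ⟨⟨⟨x, by simpa using hk⟩, ⟨u, by simpa using hu⟩⟩, G⟩, ⟨hx, hv⟩, rfl⟩
  rw [key]
  refine (MeasurableSet.iUnion fun k => IsClosed.measurableSet ?_).compl
  refine isClosedMap_snd_of_compactSpace _ ?_
  simp only [Set.ofPred_and, Set.ofPred_forall]
  have hp : Continuous fun q : (Metric.closedBall (0 : Euc n) k ×
      Metric.sphere (0 : Euc m) 1) × C1Space n m => (q.1.1 : Euc n) := by fun_prop
  refine IsClosed.inter (isClosed_eq ?_ continuous_const)
    (isClosed_iInter fun v => isClosed_eq ?_ continuous_const)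
  · exact (C1Space.continuous_toContinuousMap.comp continuous_snd).eval hp
  · exact Continuous.inner (by fun_prop)
      (((C1Space.continuous_derivMap.comp continuous_snd).eval hp).clm_apply continuous_const)

theorem samplePath_apply {Ω : Type*} {n m : ℕ} {F : Euc n → Ω → Euc m} {ω : Ω}
    (h : ContDiff ℝ 1 fun x => F x ω) (x : Euc n) :
    (samplePath F ω).1 x = F x ω := by
  simp [samplePath, h]

section RandomField

variable {Ω : Type*} [MeasurableSpace Ω] {n m : ℕ} {F : Euc n → Ω → Euc m} {P : Measure Ω}

/-- Each value is only almost everywhere measurable, and uncountably many null sets cannot be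
discarded at once. Measurable versions are therefore matched on a countable dense set, and the other
points follow by continuity of the paths. -/
theorem aemeasurable_samplePath (hF : ∀ x, AEMeasurable (F x) P)
    (hs : ∀ᵐ ω ∂P, ContDiff ℝ 1 fun x => F x ω) : AEMeasurable (samplePath F) P := by
  classical
  obtain ⟨D, hDc, hDd⟩ := TopologicalSpace.exists_countable_dense (Euc n)
  have hgood : ∀ᵐ ω ∂P, (ContDiff ℝ 1 fun x => F x ω) ∧ ∀ x ∈ D, F x ω = (hF x).mk _ ω :=
    hs.and ((ae_ball_iff hDc).2 fun x _ => (hF x).ae_eq_mk)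
  obtain ⟨S, hSsub, hSm, hSnull⟩ := exists_measurable_superset_of_null (ae_iff.1 hgood)
  have hS : ∀ ω ∉ S, (ContDiff ℝ 1 fun x => F x ω) ∧ ∀ x ∈ D, F x ω = (hF x).mk _ ω :=
    fun ω hω => by
      by_contra hc
      exact hω (hSsub hc)
  let Φ : Ω → C1Space n m := fun ω => if ω ∈ S then C1Space.zeroMap else samplePath F ω
  refine ⟨Φ, C1Space.measurable_of_eval fun x => ?_, ?_⟩
  · have hD : ∀ x ∈ D, Measurable fun ω => (Φ ω).1 x := by
      intro x hx
      have : (fun ω => (Φ ω).1 x) = fun ω => if ω ∈ S then 0 else (hF x).mk _ ω := by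
        funext ω
        by_cases hω : ω ∈ S
        · simp [Φ, hω, C1Space.zeroMap]
        · simp [Φ, hω, samplePath_apply (hS ω hω).1, (hS ω hω).2 x hx]
      rw [this]
      exact Measurable.ite hSm measurable_const (hF x).measurable_mk
    obtain ⟨y, hyD, hyx⟩ := mem_closure_iff_seq_limit.1 (hDd x)
    exact measurable_of_tendsto_metrizable (fun k => hD _ (hyD k)) (tendsto_pi_nhds.2 fun ω =>
      ((Φ ω).2.continuous.tendsto x).comp hyx)
  · filter_upwards [measure_eq_zero_iff_ae_notMem.1 hSnull] with ω hω
    simp [Φ, hω]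

end RandomField

/-! ### Gaussian limits, small ball estimates and absence of zeros. -/

theorem integral_exp_neg_sq_gaussianReal_le {b : ℝ} (hb : 0 < b) :
    ∫ z, Real.exp (-b * z ^ 2 / 2) ∂(gaussianReal 0 1) ≤ (√b)⁻¹ := by
  rw [integral_gaussianReal_eq_integral_smul one_ne_zero]
  have h : ∀ z : ℝ, gaussianPDFReal 0 1 z • Real.exp (-b * z ^ 2 / 2) =
      (√(2 * Real.pi))⁻¹ * Real.exp (-((1 + b) / 2) * z ^ 2) := by
    intro z
    simp only [gaussianPDFReal, smul_eq_mul, mul_assoc, ← Real.exp_add]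
    simp
    left
    ring
  simp_rw [h]
  rw [integral_const_mul, integral_gaussian]
  have h2 : Real.pi / ((1 + b) / 2) = 2 * Real.pi / (1 + b) := by field_simp
  rw [h2, Real.sqrt_div (by positivity), ← mul_div_assoc, inv_mul_cancel₀ (by positivity),
    one_div]
  gcongr
  linarith

/-- Quantitative small ball estimate for a random vector with a Gaussian bound on its
characteristic function. -/
theorem measureReal_norm_le_of_charFun_le {Ω κ : Type*} [MeasurableSpace Ω] [Fintype κ]
    {P : Measure Ω} [IsProbabilityMeasure P] {X : Ω → κ → ℝ} (hX : AEMeasurable X P) {c : ℝ}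
    (hc : 0 < c)
    (h : ∀ z : κ → ℝ, ‖∫ ω, Complex.exp (Complex.I * (∑ k, z k * X ω k : ℝ)) ∂P‖ ≤
      Real.exp (-c * ∑ k, z k ^ 2 / 2)) {δ : ℝ} (hδ : 0 < δ) :
    P.real {ω | ‖X ω‖ ≤ δ} ≤ (Real.exp (1 / 2) / √c * δ) ^ Fintype.card κ := by
  set γ : Measure (κ → ℝ) := Measure.pi fun _ => gaussianReal 0 1 with hγ
  -- A Gaussian bump of width δ. It is the characteristic function of the standard Gaussian at x /
  -- δ, so by Fubini the mean of g(X) is a Gaussian average of the characteristic function of X at z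
  -- / δ, where `h` applies. Since g is at least exp(-1/2) per coordinate on the sup-norm ball of
  -- radius δ, Markov's inequality concludes.
  let g : (κ → ℝ) → ℝ := fun x => ∏ k, Real.exp (-(x k / δ) ^ 2 / 2)
  have hXk : ∀ k, AEMeasurable (fun ω => X ω k) P := fun k =>
    (measurable_pi_apply k).comp_aemeasurable hX
  have hgX : AEMeasurable (fun ω => g (X ω)) P := by
    have : Measurable g := by fun_prop
    exact this.comp_aemeasurable hX
  have hg1 : ∀ x, g x ≤ 1 := fun x => Finset.prod_le_one (fun _ _ => (Real.exp_pos _).le)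
    fun k _ => Real.exp_le_one_iff.2 (by have := sq_nonneg (x k / δ); linarith)
  have hg0 : ∀ x, 0 ≤ g x := fun x => Finset.prod_nonneg fun _ _ => (Real.exp_pos _).le
  have hgint : Integrable (fun ω => g (X ω)) P :=
    Integrable.of_bound hgX.aestronglyMeasurable 1 (ae_of_all _ fun ω => by
      rw [Real.norm_of_nonneg (hg0 _)]; exact hg1 _)
  have hrep : ∀ x : κ → ℝ, (g x : ℂ) =
      ∫ z, Complex.exp (Complex.I * (∑ k, (z k / δ) * x k : ℝ)) ∂γ := by
    intro x
    have h1 : ∀ z : κ → ℝ, Complex.exp (Complex.I * (∑ k, (z k / δ) * x k : ℝ)) =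
        ∏ k, Complex.exp ((x k / δ : ℝ) * z k * Complex.I) := by
      intro z
      rw [← Complex.exp_sum]
      push_cast
      rw [Finset.mul_sum]
      congr 1
      refine Finset.sum_congr rfl fun k _ => ?_
      ring
    simp_rw [h1]
    rw [hγ, integral_fintype_prod_eq_prod
      (f := fun k (z : ℝ) => Complex.exp ((x k / δ : ℝ) * z * Complex.I))]
    simp only [g, Complex.ofReal_prod]
    refine Finset.prod_congr rfl fun k _ => ?_
    rw [← charFun_apply_real, charFun_gaussianReal]
    push_cast
    congr 1
    simp
    ring
  have hmeas : AEStronglyMeasurable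
      (fun q : Ω × (κ → ℝ) => Complex.exp (Complex.I * (∑ k, (q.2 k / δ) * X q.1 k : ℝ)))
      (P.prod γ) := by
    refine AEMeasurable.aestronglyMeasurable (Complex.measurable_exp.comp_aemeasurable
      ((Complex.measurable_ofReal.comp_aemeasurable
        (Finset.aemeasurable_fun_sum _ fun k _ => ?_)).const_mul _))
    exact AEMeasurable.mul (Measurable.aemeasurable (by fun_prop)) (hXk k).comp_fst
  have hE : ∫ ω, g (X ω) ∂P ≤ (√c)⁻¹ ^ Fintype.card κ * δ ^ Fintype.card κ := by
    calc ∫ ω, g (X ω) ∂P ≤ ‖((∫ ω, g (X ω) ∂P : ℝ) : ℂ)‖ := by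
          rw [Complex.norm_real]; exact le_abs_self _
      _ = ‖∫ z, ∫ ω, Complex.exp (Complex.I * (∑ k, (z k / δ) * X ω k : ℝ)) ∂P ∂γ‖ := by
          rw [← integral_complex_ofReal]
          simp_rw [hrep]
          rw [integral_integral_swap]
          refine Integrable.of_bound hmeas 1 (ae_of_all _ fun q => ?_)
          simp only [Function.uncurry]
          rw [mul_comm, Complex.norm_exp_ofReal_mul_I]
      _ ≤ ∫ z : κ → ℝ, ∏ k, Real.exp (-(c / δ ^ 2) * z k ^ 2 / 2) ∂γ := by
          refine norm_integral_le_of_norm_le ?_ (ae_of_all _ fun z => ?_)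
          · refine Integrable.of_bound (Measurable.aestronglyMeasurable (by fun_prop)) 1
              (ae_of_all _ fun z => ?_)
            rw [Real.norm_of_nonneg (Finset.prod_nonneg fun _ _ => (Real.exp_pos _).le)]
            refine Finset.prod_le_one (fun _ _ => (Real.exp_pos _).le)
              fun k _ => Real.exp_le_one_iff.2 ?_
            have : 0 ≤ c / δ ^ 2 * z k ^ 2 := by positivity
            linarith
          · refine (h _).trans (le_of_eq ?_)
            rw [← Real.exp_sum, Finset.mul_sum]
            congr 1
            refine Finset.sum_congr rfl fun k _ => ?_
            field_simp
      _ = ∏ _k : κ, ∫ z, Real.exp (-(c / δ ^ 2) * z ^ 2 / 2) ∂(gaussianReal 0 1) := by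
          rw [hγ, integral_fintype_prod_eq_prod
            (f := fun k (z : ℝ) => Real.exp (-(c / δ ^ 2) * z ^ 2 / 2))]
      _ ≤ ∏ _k : κ, ((√c)⁻¹ * δ) := by
          refine Finset.prod_le_prod (fun _ _ => integral_nonneg fun _ => (Real.exp_pos _).le)
            fun k _ => (integral_exp_neg_sq_gaussianReal_le (by positivity)).trans (le_of_eq ?_)
          rw [Real.sqrt_div hc.le, Real.sqrt_sq hδ.le]
          field_simp
      _ = _ := by rw [Finset.prod_const, Finset.card_univ, mul_pow]
  have hsub : {ω | ‖X ω‖ ≤ δ} ⊆ {ω | Real.exp (-1 / 2) ^ Fintype.card κ ≤ g (X ω)} := by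
    intro ω hω
    rw [Set.mem_ofPred_eq, ← Finset.card_univ, ← Finset.prod_const]
    refine Finset.prod_le_prod (fun _ _ => (Real.exp_pos _).le) fun k _ => ?_
    rw [Real.exp_le_exp]
    have h1 : |X ω k| ≤ δ := (norm_le_pi_norm (X ω) k).trans hω
    have h2 : |X ω k / δ| ≤ 1 := by
      rw [abs_div, abs_of_pos hδ]; exact (div_le_one hδ).2 h1
    have h3 := (sq_le_one_iff_abs_le_one _).2 h2
    linarith
  have hmk := mul_meas_ge_le_integral_of_nonneg (ae_of_all P fun ω => hg0 (X ω)) hgint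
    (Real.exp (-1 / 2) ^ Fintype.card κ)
  have hle := (mul_le_mul_of_nonneg_left (measureReal_mono hsub (by finiteness))
    (by positivity : 0 ≤ Real.exp (-1 / 2) ^ Fintype.card κ)).trans (hmk.trans hE)
  have hinv : Real.exp (1 / 2) * Real.exp (-1 / 2) = 1 := by rw [← Real.exp_add]; norm_num
  calc P.real {ω | ‖X ω‖ ≤ δ}
      = (Real.exp (1 / 2) * Real.exp (-1 / 2)) ^ Fintype.card κ * P.real {ω | ‖X ω‖ ≤ δ} := by
        rw [hinv, one_pow, one_mul]
    _ = Real.exp (1 / 2) ^ Fintype.card κ * (Real.exp (-1 / 2) ^ Fintype.card κ *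
          P.real {ω | ‖X ω‖ ≤ δ}) := by rw [mul_pow]; ring
    _ ≤ Real.exp (1 / 2) ^ Fintype.card κ * ((√c)⁻¹ ^ Fintype.card κ * δ ^ Fintype.card κ) := by
        gcongr
    _ = _ := by rw [mul_pow, div_eq_mul_inv _ (√c), mul_pow]; ring

/-- An almost sure limit of centered Gaussian variables is centered Gaussian. -/
theorem integral_cexp_of_tendsto_gaussian {Ω : Type*} [MeasurableSpace Ω] {P : Measure Ω}
    [IsProbabilityMeasure P] {Y : ℕ → Ω → ℝ} {Z : Ω → ℝ} {q : ℕ → ℝ}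
    (hY : ∀ k, AEMeasurable (Y k) P) (hlim : ∀ᵐ ω ∂P, Tendsto (fun k => Y k ω) atTop (𝓝 (Z ω)))
    (hq : ∀ k, 0 ≤ q k)
    (h : ∀ k (s : ℝ), ∫ ω, Complex.exp (Complex.I * (s * Y k ω : ℝ)) ∂P =
      Complex.exp ((-(s ^ 2 * q k / 2) : ℝ))) :
    Tendsto q atTop (𝓝 (∫ ω, Z ω ^ 2 ∂P)) ∧
    ∀ s : ℝ, ∫ ω, Complex.exp (Complex.I * (s * Z ω : ℝ)) ∂P =
      Complex.exp ((-(s ^ 2 * (∫ ω, Z ω ^ 2 ∂P) / 2) : ℝ)) := by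
  have hZ : AEMeasurable Z P := aemeasurable_of_tendsto_metrizable_ae atTop hY hlim
  have htend : ∀ s : ℝ, Tendsto (fun k => ((Real.exp (-(s ^ 2 * q k / 2)) : ℝ) : ℂ)) atTop
      (𝓝 (charFun (P.map Z) s)) := by
    intro s
    have e : charFun (P.map Z) s = ∫ ω, Complex.exp (Complex.I * (s * Z ω : ℝ)) ∂P := by
      rw [charFun_apply_real, integral_map hZ (by fun_prop)]
      refine integral_congr_ae (ae_of_all _ fun ω => ?_)
      simp only
      congr 1
      push_cast
      ring
    rw [e]
    simp_rw [Complex.ofReal_exp, ← h]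
    refine tendsto_integral_of_dominated_convergence (fun _ => 1) (fun k => ?_)
      (integrable_const _) (fun k => ae_of_all _ fun ω => ?_) ?_
    · have := hY k
      exact AEMeasurable.aestronglyMeasurable (by fun_prop)
    · rw [mul_comm, Complex.norm_exp_ofReal_mul_I]
    · filter_upwards [hlim] with ω hω
      exact ((Complex.continuous_exp.comp (continuous_const.mul
        (Complex.continuous_ofReal.comp (continuous_const.mul continuous_id)))).tendsto _).comp hω
  have : IsProbabilityMeasure (P.map Z) := Measure.isProbabilityMeasure_map hZ
  -- The limiting characteristic function is continuous and equals 1 at 0, so it is nonzero at some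
  -- s₀ ≠ 0. Taking logarithms there shows that the variances converge instead of escaping to
  -- infinity.
  obtain ⟨s₀, hs₀, hne⟩ : ∃ s₀ : ℝ, s₀ ≠ 0 ∧ charFun (P.map Z) s₀ ≠ 0 := by
    have hc : ContinuousAt (charFun (P.map Z)) 0 := continuous_charFun.continuousAt
    have h1 : ∀ᶠ s in 𝓝 (0 : ℝ), charFun (P.map Z) s ≠ 0 :=
      hc.eventually_ne (by simp)
    obtain ⟨s₀, h2, h3⟩ := ((h1.filter_mono nhdsWithin_le_nhds).and
      (self_mem_nhdsWithin : {(0 : ℝ)}ᶜ ∈ 𝓝[≠] 0)).exists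
    exact ⟨s₀, h3, h2⟩
  obtain ⟨v, hv⟩ : ∃ v, Tendsto q atTop (𝓝 v) := by
    have h1 := (htend s₀).norm
    simp only [Complex.norm_real, Real.norm_of_nonneg (Real.exp_pos _).le] at h1
    have h2 := h1.log (norm_ne_zero_iff.2 hne)
    simp only [Real.log_exp] at h2
    refine ⟨_, ((h2.const_mul (-2 / s₀ ^ 2))).congr fun k => ?_⟩
    field_simp
  have hv0 : 0 ≤ v := ge_of_tendsto' hv hq
  have hchar : ∀ s : ℝ, charFun (P.map Z) s = ((Real.exp (-(s ^ 2 * v / 2)) : ℝ) : ℂ) := by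
    intro s
    refine tendsto_nhds_unique (htend s) ?_
    refine (Complex.continuous_ofReal.tendsto _).comp ((Real.continuous_exp.tendsto _).comp ?_)
    exact ((hv.const_mul _).div_const _).neg
  have hlaw : P.map Z = gaussianReal 0 v.toNNReal := by
    refine Measure.ext_of_charFun (funext fun s => ?_)
    rw [hchar, charFun_gaussianReal, Real.coe_toNNReal _ hv0]
    push_cast
    congr 1
    ring
  have hvar : ∫ ω, Z ω ^ 2 ∂P = v := by
    have h1 := variance_fun_id_gaussianReal (μ := 0) (v := v.toNNReal)
    rw [variance_eq_integral measurable_id'.aemeasurable, integral_id_gaussianReal, ← hlaw,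
      Real.coe_toNNReal _ hv0, integral_map hZ (by fun_prop)] at h1
    simpa using h1
  refine ⟨hvar ▸ hv, fun s => ?_⟩
  rw [hvar, ← Complex.ofReal_exp, ← hchar, charFun_apply_real, integral_map hZ (by fun_prop)]
  refine integral_congr_ae (ae_of_all _ fun ω => ?_)
  simp only
  congr 1
  push_cast
  ring

/-- A random locally Lipschitz map from a `d`-dimensional cube whose values satisfy a small ball
estimate of order `d + 1` almost surely has no zero. -/
theorem ae_forall_ne_zero_of_small_ball {Ω ι E : Type*} [MeasurableSpace Ω] [Fintype ι]
    [NormedAddCommGroup E] {P : Measure Ω} [IsProbabilityMeasure P] {V : (ι → ℝ) → Ω → E}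
    {M : ℕ} {C : ℝ} (hC : 0 ≤ C)
    (hsmall : ∀ p ∈ Metric.closedBall (0 : ι → ℝ) M, ∀ δ > 0,
      P.real {ω | ‖V p ω‖ ≤ δ} ≤ (C * δ) ^ (Fintype.card ι + 1))
    (hlip : ∀ᵐ ω ∂P, ∃ L : ℝ≥0,
      LipschitzOnWith L (fun p => V p ω) (Metric.closedBall (0 : ι → ℝ) M)) :
    ∀ᵐ ω ∂P, ∀ p ∈ Metric.closedBall (0 : ι → ℝ) M, V p ω ≠ 0 := by
  classical
  set B := Metric.closedBall (0 : ι → ℝ) M with hB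
  have hnull : ∀ L : ℕ, P {ω | LipschitzOnWith L (fun p => V p ω) B ∧ ∃ p ∈ B, V p ω = 0} = 0 := by
    intro L
    set d := Fintype.card ι
    set A := {ω | LipschitzOnWith L (fun p => V p ω) B ∧ ∃ p ∈ B, V p ω = 0}
    have hbound : ∀ N : ℕ, P.real A ≤
        (2 * M + 1) ^ d * (C * (L + 1)) ^ (d + 1) * (1 / ((N : ℝ) + 1)) := by
      intro N
      set N' : ℝ := (N : ℝ) + 1 with hN'
      have hNpos : 0 < N' := by positivity
      let grid : Finset (ι → ℤ) :=
        Fintype.piFinset fun _ => Finset.Icc (-(M * (N + 1) : ℤ)) (M * (N + 1))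
      let pt : (ι → ℤ) → ι → ℝ := fun a i => a i / N'
      have hpt : ∀ a ∈ grid, pt a ∈ B := by
        intro a ha
        rw [hB, mem_closedBall_zero_iff, pi_norm_le_iff_of_nonneg (by positivity)]
        intro i
        have hi := Finset.mem_Icc.1 (Fintype.mem_piFinset.1 ha i)
        have h1 : (-(M * N') : ℝ) ≤ a i := by rw [hN']; exact_mod_cast hi.1
        have h2 : (a i : ℝ) ≤ M * N' := by rw [hN']; exact_mod_cast hi.2
        rw [Real.norm_eq_abs, abs_div, abs_of_pos hNpos, div_le_iff₀ hNpos]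
        exact abs_le.2 ⟨h1, h2⟩
      -- Rounding down moves a zero by at most 1 / N' in sup norm and stays in the cube because M *
      -- N' is an integer. The radius uses L + 1 instead of L so that it is positive even for L = 0.
      have hcover : A ⊆ ⋃ a ∈ grid, {ω | ‖V (pt a) ω‖ ≤ (L + 1) / N'} := by
        rintro ω ⟨hL, p, hp, hp0⟩
        have hpi : ∀ i, |p i| ≤ M := fun i =>
          (norm_le_pi_norm p i).trans (mem_closedBall_zero_iff.1 hp)
        have ha : (fun i => ⌊p i * N'⌋) ∈ grid := by
          refine Fintype.mem_piFinset.2 fun i => Finset.mem_Icc.2 ⟨?_, ?_⟩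
          · refine Int.le_floor.2 ?_
            push_cast
            have := mul_le_mul_of_nonneg_right (abs_le.1 (hpi i)).1 hNpos.le
            rw [← hN']; linarith
          · refine Int.cast_le.1 ((Int.floor_le (p i * N')).trans ?_)
            push_cast
            exact mul_le_mul_of_nonneg_right (abs_le.1 (hpi i)).2 hNpos.le
        simp only [Set.mem_iUnion, Set.mem_ofPred_eq]
        refine ⟨_, ha, ?_⟩
        have hd : dist (pt fun i => ⌊p i * N'⌋) p ≤ 1 / N' := by
          rw [dist_pi_le_iff (by positivity)]
          intro i
          have h1 := Int.floor_le (p i * N')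
          have h2 := (Int.lt_floor_add_one (p i * N')).le
          have h3 : pt (fun i => ⌊p i * N'⌋) i - p i = (⌊p i * N'⌋ - p i * N') / N' := by
            simp only [pt]; field_simp
          rw [Real.dist_eq, h3, abs_div, abs_of_pos hNpos]
          gcongr
          exact abs_le.2 ⟨by linarith, by linarith⟩
        have := hL.dist_le_mul _ (hpt _ ha) p hp
        rw [hp0, dist_zero_right] at this
        refine this.trans ?_
        have h4 : ((L : ℝ≥0) : ℝ) = L := by simp
        rw [h4]
        calc (L : ℝ) * dist (pt fun i => ⌊p i * N'⌋) p ≤ L * (1 / N') := by gcongr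
          _ ≤ (L + 1) / N' := by rw [mul_one_div]; gcongr; linarith
      have hcard : (grid.card : ℝ) ≤ ((2 * M + 1) * N') ^ d := by
        have h1 : grid.card = (2 * (M * (N + 1)) + 1) ^ d := by
          have : (M : ℤ) * (N + 1) + 1 - -(M * (N + 1)) = ((2 * (M * (N + 1)) + 1 : ℕ) : ℤ) := by
            push_cast; ring
          rw [Fintype.card_piFinset, Finset.prod_const, Finset.card_univ, Int.card_Icc, this,
            Int.toNat_natCast]
        rw [h1]
        push_cast
        rw [← hN']
        gcongr
        have : (1 : ℝ) ≤ N' := by rw [hN']; linarith [(Nat.cast_nonneg N : (0 : ℝ) ≤ N)]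
        nlinarith
      calc P.real A ≤ P.real (⋃ a ∈ grid, {ω | ‖V (pt a) ω‖ ≤ (L + 1) / N'}) :=
            measureReal_mono hcover (measure_ne_top _ _)
        _ ≤ ∑ a ∈ grid, P.real {ω | ‖V (pt a) ω‖ ≤ (L + 1) / N'} :=
            measureReal_biUnion_finset_le _ _
        _ ≤ ∑ _a ∈ grid, (C * ((L + 1) / N')) ^ (d + 1) :=
            Finset.sum_le_sum fun a ha => hsmall _ (hpt a ha) _ (by positivity)
        _ = grid.card * (C * ((L + 1) / N')) ^ (d + 1) := by rw [Finset.sum_const, nsmul_eq_mul]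
        _ ≤ ((2 * M + 1) * N') ^ d * (C * ((L + 1) / N')) ^ (d + 1) := by gcongr
        _ = _ := by
            rw [← mul_div_assoc, div_pow, mul_pow]
            field_simp
            ring
    have hlim := tendsto_one_div_add_atTop_nhds_zero_nat.const_mul
      ((2 * (M : ℝ) + 1) ^ d * (C * (L + 1)) ^ (d + 1))
    rw [mul_zero] at hlim
    have h0 : P.real A = 0 := le_antisymm (ge_of_tendsto' hlim hbound) measureReal_nonneg
    exact (measureReal_eq_zero_iff (by finiteness)).1 h0
  filter_upwards [hlip, ae_all_iff.2 fun L => measure_eq_zero_iff_ae_notMem.1 (hnull L)]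
    with ω ⟨L, hL⟩ hω p hp hp0
  obtain ⟨k, hk⟩ := exists_nat_ge L
  exact hω k ⟨hL.weaken hk, p, hp, hp0⟩

/-! ### Finite linear functionals of the field and their covariances. -/

/-- The linear functional `G ↦ ∑ₓ ⟪t x, G x⟫` on maps `ℝⁿ → ℝᵐ`. -/
noncomputable def linEval {n m : ℕ} (t : Euc n →₀ Euc m) (G : Euc n → Euc m) : ℝ :=
  t.sum fun x a => inner ℝ a (G x)

/-- The translate by `v` of the functional given by `t`. -/
noncomputable def shiftCoeff {n m : ℕ} (v : Euc n) (t : Euc n →₀ Euc m) : Euc n →₀ Euc m :=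
  t.mapDomain (· + v)

section LinEval

variable {n m : ℕ}

theorem linEval_add (s t : Euc n →₀ Euc m) (G : Euc n → Euc m) :
    linEval (s + t) G = linEval s G + linEval t G :=
  Finsupp.sum_add_index' (fun _ => inner_zero_left _) fun _ _ _ => inner_add_left _ _ _

theorem linEval_single (x : Euc n) (a : Euc m) (G : Euc n → Euc m) :
    linEval (Finsupp.single x a) G = inner ℝ a (G x) :=
  Finsupp.sum_single_index (inner_zero_left _)

theorem linEval_smul (c : ℝ) (t : Euc n →₀ Euc m) (G : Euc n → Euc m) :
    linEval (c • t) G = c * linEval t G := by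
  have h := Finsupp.sum_smul_index' (g := t) (b := c) (h := fun x a => inner ℝ a (G x))
    fun _ => inner_zero_left _
  simp only [linEval, h, real_inner_smul_left]
  exact (Finset.mul_sum _ _ _).symm

theorem linEval_neg (t : Euc n →₀ Euc m) (G : Euc n → Euc m) :
    linEval (-t) G = -linEval t G := by
  simpa using linEval_smul (-1) t G

theorem linEval_zero (G : Euc n → Euc m) : linEval 0 G = 0 := Finsupp.sum_zero_index

theorem linEval_sum {ι : Type*} (A : Finset ι) (t : ι → Euc n →₀ Euc m) (G : Euc n → Euc m) :
    linEval (∑ i ∈ A, t i) G = ∑ i ∈ A, linEval (t i) G := by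
  classical
  induction A using Finset.induction_on with
  | empty => simp [linEval_zero]
  | insert i A hi ih => rw [Finset.sum_insert hi, Finset.sum_insert hi, linEval_add, ih]

theorem linEval_shiftCoeff (v : Euc n) (t : Euc n →₀ Euc m) (G : Euc n → Euc m) :
    linEval (shiftCoeff v t) G = linEval t fun x => G (x + v) :=
  Finsupp.sum_mapDomain_index (fun _ => inner_zero_left _) fun _ _ _ => inner_add_left _ _ _

end LinEval

section Field

variable {Ω : Type*} [MeasurableSpace Ω] {P : Measure Ω} {n m : ℕ} {F : Euc n → Ω → Euc m}

theorem hasGaussianLaw_linEval (hF : IsGaussianProcess F P) (t : Euc n →₀ Euc m) :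
    HasGaussianLaw (fun ω => linEval t fun x => F x ω) P := by
  let L : (t.support → Euc m) →L[ℝ] ℝ :=
    ∑ x : t.support, (innerSL ℝ (t x)).comp (ContinuousLinearMap.proj x)
  have h := (hF.hasGaussianLaw t.support).map_fun L
  have hL : (fun ω => L (t.support.restrict fun x => F x ω)) =
      fun ω => linEval t fun x => F x ω := by
    funext ω
    simp only [L, linEval, Finsupp.sum, sum_apply,
      ContinuousLinearMap.comp_apply, ContinuousLinearMap.proj_apply, innerSL_apply_apply,
      Finset.restrict]
    exact Finset.sum_coe_sort t.support fun x => inner ℝ (t x) (F x ω)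
  exact hL ▸ h

theorem aemeasurable_linEval (hF : IsGaussianProcess F P) (t : Euc n →₀ Euc m) :
    AEMeasurable (fun ω => linEval t fun x => F x ω) P :=
  (hasGaussianLaw_linEval hF t).aemeasurable

theorem hasGaussianLaw_coord (hF : IsGaussianProcess F P) (x : Euc n) (i : Fin m) :
    HasGaussianLaw (fun ω => F x ω i) P :=
  (hF.hasGaussianLaw_eval x).map_fun (EuclideanSpace.proj i)

theorem integral_linEval (hc : IsCenteredField F P)
    (t : Euc n →₀ Euc m) : ∫ ω, linEval t (fun x => F x ω) ∂P = 0 := by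
  simp only [linEval, Finsupp.sum, PiLp.inner_apply]
  rw [integral_finsetSum]
  · refine Finset.sum_eq_zero fun x _ => ?_
    rw [integral_finsetSum]
    · refine Finset.sum_eq_zero fun i _ => ?_
      simp only [RCLike.inner_apply, conj_trivial]
      rw [integral_mul_const, (hc x i).2, zero_mul]
    · intro i _
      simpa using (hc x i).1.mul_const _
  · intro x _
    refine integrable_finsetSum _ fun i _ => ?_
    simpa using (hc x i).1.mul_const _

theorem integral_cexp_linEval (hF : IsGaussianProcess F P) (hc : IsCenteredField F P)
    (t : Euc n →₀ Euc m) :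
    ∫ ω, Complex.exp (Complex.I * (linEval t fun x => F x ω : ℝ)) ∂P =
      Complex.exp ((-((∫ ω, (linEval t fun x => F x ω) ^ 2 ∂P) / 2) : ℝ)) := by
  have hG := hasGaussianLaw_linEval hF t
  have h := hG.charFun_map_eq 1
  rw [charFun_apply_real, integral_map hG.aemeasurable (by fun_prop)] at h
  have hm : ∫ ω, inner ℝ 1 (linEval t fun x => F x ω) ∂P = 0 := by
    simpa using integral_linEval hc t
  have hv : Var[fun ω => inner ℝ (1 : ℝ) (linEval t fun x => F x ω); P] =
      ∫ ω, (linEval t fun x => F x ω) ^ 2 ∂P := by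
    rw [variance_of_integral_eq_zero _ hm]
    · simp
    · simpa using hG.aemeasurable
  rw [hm, hv] at h
  have e : ∀ ω, Complex.exp (Complex.I * (linEval t fun x => F x ω : ℝ)) =
      Complex.exp (((1 : ℝ) : ℂ) * (linEval t fun x => F x ω : ℝ) * Complex.I) := by
    intro ω
    congr 1
    push_cast
    ring
  simp_rw [e]
  rw [h]
  congr 1
  push_cast
  ring

/-- The covariance of the coefficients `a` at `x` and `b` at `x + z`. -/
noncomputable def covForm (F : Euc n → Ω → Euc m) (P : Measure Ω) (a b : Euc m) (z : Euc n) : ℝ :=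
  ∑ i, ∑ j, a i * b j * covFun F P j i z

/-- Stationarity moves the pair (x, y) to (0, y - x). In `covFun` the second index belongs to the
value at the origin, hence the order `j i`. -/
theorem integral_coord_mul_coord (hF : IsGaussianProcess F P) (hs : IsStationaryField F P)
    (x y : Euc n) (i j : Fin m) :
    ∫ ω, F x ω i * F y ω j ∂P = covFun F P j i (y - x) := by
  have h := hs 2 ![0, y - x] x
  have hm : ∀ v : Euc n, AEMeasurable (fun ω (k : Fin 2) => F (![0, y - x] k + v) ω) P :=
    fun v => aemeasurable_pi_lambda _ fun k => hF.aemeasurable _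
  have hm0 : AEMeasurable (fun ω (k : Fin 2) => F (![0, y - x] k) ω) P :=
    aemeasurable_pi_lambda _ fun k => hF.aemeasurable _
  have hi := congrArg (fun ν : Measure (Fin 2 → Euc m) => ∫ w, w 0 i * w 1 j ∂ν) h
  simp only at hi
  rw [integral_map (hm x) (by fun_prop), integral_map hm0 (by fun_prop)] at hi
  simp only [Matrix.cons_val_zero, Matrix.cons_val_one, zero_add, sub_add_cancel] at hi
  rw [hi, covFun]
  simp_rw [mul_comm]

theorem integral_linEval_mul_linEval (hF : IsGaussianProcess F P) (hs : IsStationaryField F P)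
    (s t : Euc n →₀ Euc m) :
    ∫ ω, (linEval s fun x => F x ω) * (linEval t fun x => F x ω) ∂P =
      s.sum fun x a => t.sum fun y b => covForm F P a b (y - x) := by
  have hexp : ∀ ω, (linEval s fun x => F x ω) * (linEval t fun x => F x ω) =
      ∑ x ∈ s.support, ∑ y ∈ t.support, ∑ i, ∑ j, s x i * t y j * (F x ω i * F y ω j) := by
    intro ω
    simp only [linEval, Finsupp.sum, Finset.sum_mul_sum, PiLp.inner_apply, RCLike.inner_apply,
      conj_trivial]
    refine Finset.sum_congr rfl fun x _ => Finset.sum_congr rfl fun y _ =>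
      Finset.sum_congr rfl fun i _ => Finset.sum_congr rfl fun j _ => ?_
    ring
  have hint : ∀ x y i j, Integrable (fun ω => s x i * t y j * (F x ω i * F y ω j)) P :=
    fun x y i j => (((hasGaussianLaw_coord hF x i).memLp_two.integrable_mul
      (hasGaussianLaw_coord hF y j).memLp_two)).const_mul _
  simp_rw [hexp, Finsupp.sum, covForm]
  rw [integral_finsetSum _ fun x _ => integrable_finsetSum _ fun y _ =>
    integrable_finsetSum _ fun i _ => integrable_finsetSum _ fun j _ => hint x y i j]
  refine Finset.sum_congr rfl fun x _ => ?_
  rw [integral_finsetSum _ fun y _ =>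
    integrable_finsetSum _ fun i _ => integrable_finsetSum _ fun j _ => hint x y i j]
  refine Finset.sum_congr rfl fun y _ => ?_
  rw [integral_finsetSum _ fun i _ => integrable_finsetSum _ fun j _ => hint x y i j]
  refine Finset.sum_congr rfl fun i _ => ?_
  rw [integral_finsetSum _ fun j _ => hint x y i j]
  refine Finset.sum_congr rfl fun j _ => ?_
  rw [integral_const_mul, integral_coord_mul_coord hF hs]

theorem covForm_zero_left (b : Euc m) (z : Euc n) : covForm F P 0 b z = 0 := by
  simp [covForm]

theorem covForm_zero_right (a : Euc m) (z : Euc n) : covForm F P a 0 z = 0 := by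
  simp [covForm]

theorem covForm_add_left (a a' b : Euc m) (z : Euc n) :
    covForm F P (a + a') b z = covForm F P a b z + covForm F P a' b z := by
  simp [covForm, add_mul, Finset.sum_add_distrib]

theorem covForm_add_right (a b b' : Euc m) (z : Euc n) :
    covForm F P a (b + b') z = covForm F P a b z + covForm F P a b' z := by
  simp [covForm, add_mul, mul_add, Finset.sum_add_distrib]

theorem sum_shiftCoeff_covForm (v x : Euc n) (a : Euc m) (t : Euc n →₀ Euc m) :
    ((shiftCoeff v t).sum fun y b => covForm F P a b (y - x)) =
      t.sum fun y b => covForm F P a b (y - x + v) := by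
  rw [shiftCoeff, Finsupp.sum_mapDomain_index (h := fun y b => covForm F P a b (y - x))
    (fun _ => covForm_zero_right _ _) fun _ _ _ => covForm_add_right _ _ _ _]
  simp only [add_sub_right_comm]

theorem integral_sq_linEval_shiftCoeff (hF : IsGaussianProcess F P) (hs : IsStationaryField F P)
    (v : Euc n) (t : Euc n →₀ Euc m) :
    ∫ ω, (linEval (shiftCoeff v t) fun x => F x ω) ^ 2 ∂P =
      ∫ ω, (linEval t fun x => F x ω) ^ 2 ∂P := by
  simp_rw [sq]
  rw [integral_linEval_mul_linEval hF hs, integral_linEval_mul_linEval hF hs]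
  simp_rw [sum_shiftCoeff_covForm]
  rw [shiftCoeff, Finsupp.sum_mapDomain_index]
  · refine Finsupp.sum_congr fun x _ => Finsupp.sum_congr fun y _ => ?_
    congr 1
    abel
  · intro x
    simp [covForm_zero_left, Finsupp.sum]
  · intro x a a'
    simp [covForm_add_left, Finsupp.sum, Finset.sum_add_distrib]

theorem integral_sq_linEval_add (hF : IsGaussianProcess F P) (s t : Euc n →₀ Euc m) :
    ∫ ω, (linEval (s + t) fun x => F x ω) ^ 2 ∂P =
      ∫ ω, (linEval s fun x => F x ω) ^ 2 ∂P + ∫ ω, (linEval t fun x => F x ω) ^ 2 ∂P +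
        2 * ∫ ω, (linEval s fun x => F x ω) * (linEval t fun x => F x ω) ∂P := by
  have hs := (hasGaussianLaw_linEval hF s).memLp_two
  have ht := (hasGaussianLaw_linEval hF t).memLp_two
  have hst : Integrable (fun ω => (linEval s fun x => F x ω) * linEval t fun x => F x ω) P :=
    hs.integrable_mul ht
  have e : ∀ ω, (linEval (s + t) fun x => F x ω) ^ 2 =
      (linEval s fun x => F x ω) ^ 2 + (linEval t fun x => F x ω) ^ 2 +
        2 * ((linEval s fun x => F x ω) * linEval t fun x => F x ω) := fun ω => by
    rw [linEval_add]; ring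
  simp_rw [e]
  rw [integral_add _ (hst.const_mul 2), integral_add hs.integrable_sq ht.integrable_sq,
    integral_const_mul]
  exact hs.integrable_sq.add ht.integrable_sq

/-- The covariance function of a Gaussian field with continuous paths is continuous. -/
theorem continuous_covFun (hF : IsGaussianProcess F P) (hc : IsCenteredField F P)
    (hs : IsStationaryField F P) (hcont : ∀ᵐ ω ∂P, Continuous fun x => F x ω) (i j : Fin m) :
    Continuous (covFun F P i j) := by
  have := hF.isProbabilityMeasure
  let t : Euc n → Euc n →₀ Euc m := fun x =>
    Finsupp.single x (EuclideanSpace.single i 1) + Finsupp.single 0 (EuclideanSpace.single j 1)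
  have ht : ∀ x G, linEval (t x) G = G x i + G 0 j := by
    intro x G
    simp only [t, linEval_add, linEval_single, EuclideanSpace.inner_single_left, map_one, one_mul]
  -- The variance of f_i(x) + f_j(0) is affine in the covariance. Its characteristic function at 1
  -- is continuous in x by dominated convergence, and a logarithm recovers the variance, so no
  -- moment bound uniform in x is required.
  have hQ : ∀ x, ∫ ω, (linEval (t x) fun x => F x ω) ^ 2 ∂P =
      covFun F P i i 0 + covFun F P j j 0 + 2 * covFun F P i j x := by
    intro x
    rw [integral_sq_linEval_add hF]
    simp only [linEval_single, EuclideanSpace.inner_single_left, map_one, one_mul, sq]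
    rw [integral_coord_mul_coord hF hs, integral_coord_mul_coord hF hs, sub_self, sub_self]
    rfl
  have hch : Continuous fun x => ∫ ω, Complex.exp (Complex.I *
      (linEval (t x) fun x => F x ω : ℝ)) ∂P := by
    refine continuous_of_dominated (bound := fun _ => 1) (fun x => ?_)
      (fun x => ae_of_all _ fun ω => ?_) (integrable_const _) ?_
    · have := aemeasurable_linEval hF (t x)
      exact AEMeasurable.aestronglyMeasurable (by fun_prop)
    · rw [mul_comm, Complex.norm_exp_ofReal_mul_I]
    · filter_upwards [hcont] with ω hω
      simp only [ht]
      fun_prop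
  simp_rw [integral_cexp_linEval hF hc, hQ, ← Complex.ofReal_exp] at hch
  have h1 := Complex.continuous_re.comp hch
  simp only [Function.comp_def, Complex.ofReal_re] at h1
  have h2 := h1.log fun x => (Real.exp_pos _).ne'
  simp only [Real.log_exp] at h2
  refine (h2.neg.sub (continuous_const (y := (covFun F P i i 0 + covFun F P j j 0) / 2))).congr
    fun x => ?_
  simp only [Pi.sub_apply, Pi.neg_apply]
  ring

end Field

/-! ### Bulinskaya's lemma. -/

section Bulinskaya

variable {Ω : Type*} {n m : ℕ} {F : Euc n → Ω → Euc m}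

/-- A linear combination of the values and the partial derivatives of the field at `x`. -/
noncomputable def jetForm (F : Euc n → Ω → Euc m) (η : Fin m → ℝ) (ξ : Fin m → Fin n → ℝ)
    (x : Euc n) (ω : Ω) : ℝ :=
  ∑ i, η i * F x ω i + ∑ i, ∑ j, ξ i j * partialDerivField F i j x ω

/-- The coefficients of the difference quotient approximating `jetForm` at the origin. -/
noncomputable def jetCoeff (n m : ℕ) (η : Fin m → ℝ) (ξ : Fin m → Fin n → ℝ) (k : ℕ) :
    Euc n →₀ Euc m :=
  ∑ i, Finsupp.single 0 (EuclideanSpace.single i (η i)) +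
    ∑ i, ∑ j, (k : ℝ) •
      (Finsupp.single ((k : ℝ)⁻¹ • EuclideanSpace.single j 1) (EuclideanSpace.single i (ξ i j)) +
        -Finsupp.single 0 (EuclideanSpace.single i (ξ i j)))

theorem tendsto_linEval_jetCoeff (η : Fin m → ℝ) (ξ : Fin m → Fin n → ℝ) (x : Euc n) {ω : Ω}
    (h : ContDiff ℝ 1 fun x => F x ω) :
    Tendsto (fun k => linEval (shiftCoeff x (jetCoeff n m η ξ k)) fun y => F y ω) atTop
      (𝓝 (jetForm F η ξ x ω)) := by
  have hd := (h.differentiable one_ne_zero x).hasFDerivAt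
  simp only [linEval_shiftCoeff, jetCoeff, linEval_add, linEval_sum, linEval_single, linEval_smul,
    linEval_neg, EuclideanSpace.inner_single_left, zero_add, jetForm, conj_trivial]
  refine tendsto_const_nhds.add (tendsto_finsetSum _ fun i _ => tendsto_finsetSum _ fun j _ => ?_)
  have hlim := (hd.lim_real (EuclideanSpace.single j 1)).comp (tendsto_natCast_atTop_atTop (R := ℝ))
  have hcoord := ((EuclideanSpace.proj (𝕜 := ℝ) i).continuous.tendsto _).comp hlim
  refine (hcoord.const_mul (ξ i j)).congr fun k => ?_
  simp only [Function.comp_apply, PiLp.proj_apply, PiLp.smul_apply, PiLp.sub_apply,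
    smul_eq_mul, add_comm x]
  ring

variable [MeasurableSpace Ω] {P : Measure Ω}

theorem aemeasurable_jetForm (hF : IsGaussianProcess F P)
    (hC : ∀ᵐ ω ∂P, ContDiff ℝ 1 fun x => F x ω) (η : Fin m → ℝ) (ξ : Fin m → Fin n → ℝ)
    (x : Euc n) : AEMeasurable (jetForm F η ξ x) P :=
  aemeasurable_of_tendsto_metrizable_ae atTop (fun _ => aemeasurable_linEval hF _)
    (hC.mono fun _ h => tendsto_linEval_jetCoeff η ξ x h)

theorem aemeasurable_partialDerivField (hF : IsGaussianProcess F P)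
    (hC : ∀ᵐ ω ∂P, ContDiff ℝ 1 fun x => F x ω) (i : Fin m) (j : Fin n) (x : Euc n) :
    AEMeasurable (partialDerivField F i j x) P := by
  have h := aemeasurable_jetForm hF hC 0 (fun i' j' => if i' = i ∧ j' = j then 1 else 0) x
  convert h using 1
  funext ω
  simp [jetForm, ite_and]

theorem le_integral_sq_jetForm {κ : ℝ}
    (h : ∀ (η : Fin m → ℝ) (ξ : Fin m → Fin n → ℝ), ∑ i, η i ^ 2 + ∑ i, ∑ j, ξ i j ^ 2 = 1 →
      κ ≤ ∫ ω, |jetForm F η ξ 0 ω| ^ 2 ∂P) (η : Fin m → ℝ) (ξ : Fin m → Fin n → ℝ) :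
    κ * (∑ i, η i ^ 2 + ∑ i, ∑ j, ξ i j ^ 2) ≤ ∫ ω, jetForm F η ξ 0 ω ^ 2 ∂P := by
  set N := ∑ i, η i ^ 2 + ∑ i, ∑ j, ξ i j ^ 2 with hN
  have hN0 : 0 ≤ N := by positivity
  rcases hN0.eq_or_lt with h0 | hpos
  · rw [← h0, mul_zero]
    exact integral_nonneg fun _ => sq_nonneg _
  · have hs : √N ^ 2 = N := Real.sq_sqrt hN0
    have h1 := h (fun i => η i / √N) (fun i j => ξ i j / √N) (by
      simp_rw [div_pow, hs, ← Finset.sum_div, ← add_div]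
      exact div_self hpos.ne')
    have h2 : ∀ ω, |jetForm F (fun i => η i / √N) (fun i j => ξ i j / √N) 0 ω| ^ 2 =
        jetForm F η ξ 0 ω ^ 2 / N := by
      intro ω
      have : jetForm F (fun i => η i / √N) (fun i j => ξ i j / √N) 0 ω =
          jetForm F η ξ 0 ω / √N := by
        simp only [jetForm, div_mul_eq_mul_div, ← Finset.sum_div, ← add_div]
      rw [this, sq_abs, div_pow, hs]
    simp_rw [h2] at h1
    rwa [integral_div, le_div_iff₀ hpos] at h1

/-- The jet at x is an almost sure limit of difference quotients whose variances do not depend on x.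
The limiting variance is therefore the one at 0, where nondegeneracy bounds it below; the covariance
is never differentiated. -/
theorem norm_integral_cexp_jetForm_le (hF : IsGaussianProcess F P) (hc : IsCenteredField F P)
    (hs : IsStationaryField F P) (hC : ∀ᵐ ω ∂P, ContDiff ℝ 1 fun x => F x ω) {κ : ℝ}
    (h : ∀ (η : Fin m → ℝ) (ξ : Fin m → Fin n → ℝ), ∑ i, η i ^ 2 + ∑ i, ∑ j, ξ i j ^ 2 = 1 →
      κ ≤ ∫ ω, |jetForm F η ξ 0 ω| ^ 2 ∂P) (η : Fin m → ℝ) (ξ : Fin m → Fin n → ℝ) (x : Euc n) :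
    ‖∫ ω, Complex.exp (Complex.I * (jetForm F η ξ x ω : ℝ)) ∂P‖ ≤
      Real.exp (-κ * (∑ i, η i ^ 2 + ∑ i, ∑ j, ξ i j ^ 2) / 2) := by
  have := hF.isProbabilityMeasure
  have key := fun x => integral_cexp_of_tendsto_gaussian
    (Y := fun k ω => linEval (shiftCoeff x (jetCoeff n m η ξ k)) fun y => F y ω)
    (q := fun k => ∫ ω, (linEval (jetCoeff n m η ξ k) fun y => F y ω) ^ 2 ∂P)
    (fun k => aemeasurable_linEval hF _)
    (hC.mono fun _ h => tendsto_linEval_jetCoeff η ξ x h)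
    (fun k => integral_nonneg fun _ => sq_nonneg _) (fun k s => by
      simp_rw [← linEval_smul]
      rw [integral_cexp_linEval hF hc]
      simp_rw [linEval_smul, mul_pow]
      rw [integral_const_mul, integral_sq_linEval_shiftCoeff hF hs])
  have hx := (key x).2 1
  rw [tendsto_nhds_unique (key x).1 (key 0).1] at hx
  simp only [one_mul, one_pow] at hx
  rw [hx, ← Complex.ofReal_exp, Complex.norm_real, Real.norm_of_nonneg (Real.exp_pos _).le,
    Real.exp_le_exp]
  have := le_integral_sq_jetForm h η ξ
  linarith

/-- Bulinskaya's lemma: almost every path of a nondegenerate smooth Gaussian field has a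
surjective derivative at each of its zeros. -/
theorem ae_forall_surjective_fderiv (hF : IsGaussianProcess F P)
    (hc : IsCenteredField F P) (hs : IsStationaryField F P) (hnd : IsNondegenerateAtZero F P)
    (hC2 : ∀ᵐ ω ∂P, ContDiff ℝ 2 fun x => F x ω) :
    ∀ᵐ ω ∂P, ∀ x, F x ω = 0 → Function.Surjective (fderiv ℝ (fun y => F y ω) x) := by
  classical
  have := hF.isProbabilityMeasure
  have hC : ∀ᵐ ω ∂P, ContDiff ℝ 1 fun x => F x ω := hC2.mono fun _ h => h.of_le one_le_two
  obtain ⟨κ, hκ, hnd⟩ := hnd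
  -- Directions are taken up to scaling, in charts indexed by i₀: the coordinate i₀ is set to 1 and
  -- the others are free. This leaves n + (m - 1) parameters, one fewer than the n + m components of
  -- `V`.
  let pos (i₀ : Fin m) (p : Fin n ⊕ {i // i ≠ i₀} → ℝ) : Euc n :=
    WithLp.toLp 2 fun j => p (Sum.inl j)
  let dir (i₀ : Fin m) (p : Fin n ⊕ {i // i ≠ i₀} → ℝ) (i : Fin m) : ℝ :=
    if h : i = i₀ then 1 else p (Sum.inr ⟨i, h⟩)
  let V (i₀ : Fin m) (p : Fin n ⊕ {i // i ≠ i₀} → ℝ) (ω : Ω) : Fin m ⊕ Fin n → ℝ :=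
    Sum.elim (fun i => F (pos i₀ p) ω i)
      fun j => ∑ i, dir i₀ p i * partialDerivField F i j (pos i₀ p) ω
  have hcard : ∀ i₀ : Fin m, Fintype.card (Fin m ⊕ Fin n) =
      Fintype.card (Fin n ⊕ {i // i ≠ i₀}) + 1 := by
    intro i₀
    have := i₀.pos
    simp only [Fintype.card_sum, Fintype.card_fin, Fintype.card_subtype_compl,
      Fintype.card_subtype_eq]
    omega
  have hVm : ∀ i₀ p, AEMeasurable (V i₀ p) P := by
    intro i₀ p
    refine aemeasurable_pi_lambda _ fun k => ?_
    rcases k with i | j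
    · exact (hasGaussianLaw_coord hF _ i).aemeasurable
    · exact Finset.aemeasurable_fun_sum _ fun i _ =>
        (aemeasurable_partialDerivField hF hC i j _).const_mul _
  have hchar : ∀ i₀ p (z : Fin m ⊕ Fin n → ℝ),
      ‖∫ ω, Complex.exp (Complex.I * (∑ k, z k * V i₀ p ω k : ℝ)) ∂P‖ ≤
        Real.exp (-κ * ∑ k, z k ^ 2 / 2) := by
    intro i₀ p z
    have hsum : ∀ ω, ∑ k, z k * V i₀ p ω k =
        jetForm F (fun i => z (Sum.inl i)) (fun i j => dir i₀ p i * z (Sum.inr j))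
          (pos i₀ p) ω := by
      intro ω
      simp only [Fintype.sum_sum_type, V, Sum.elim_inl, Sum.elim_inr, jetForm, Finset.mul_sum]
      congr 1
      rw [Finset.sum_comm]
      refine Finset.sum_congr rfl fun i _ => Finset.sum_congr rfl fun j _ => ?_
      ring
    simp_rw [hsum]
    refine (norm_integral_cexp_jetForm_le hF hc hs hC hnd _ _ _).trans (Real.exp_le_exp.2 ?_)
    -- The coordinate i₀ of the direction is 1, so its row alone already contributes the left side;
    -- the constant κ is kept uniformly in the parameters.
    have h1 : ∑ j, z (Sum.inr j) ^ 2 ≤ ∑ i, ∑ j, (dir i₀ p i * z (Sum.inr j)) ^ 2 := by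
      refine le_trans (le_of_eq ?_) (Finset.single_le_sum
        (f := fun i => ∑ j, (dir i₀ p i * z (Sum.inr j)) ^ 2)
        (fun i _ => by positivity) (Finset.mem_univ i₀))
      simp [dir]
    rw [← Finset.sum_div, Fintype.sum_sum_type]
    nlinarith
  have hzero : ∀ᵐ ω ∂P, ∀ (i₀ : Fin m) (M : ℕ),
      ∀ p ∈ Metric.closedBall (0 : Fin n ⊕ {i // i ≠ i₀} → ℝ) M, V i₀ p ω ≠ 0 := by
    refine ae_all_iff.2 fun i₀ => ae_all_iff.2 fun M => ?_
    refine ae_forall_ne_zero_of_small_ball (C := Real.exp (1 / 2) / √κ) (by positivity)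
      (fun p _ δ hδ => ?_) ?_
    · rw [← hcard i₀]
      exact measureReal_norm_le_of_charFun_le (hVm i₀ p) hκ (hchar i₀ p) hδ
    · filter_upwards [hC2] with ω hω
      have hpos : ContDiff ℝ 1 (pos i₀) :=
        contDiff_euclidean.2 fun j => contDiff_apply ℝ ℝ (Sum.inl j)
      have hV : ContDiff ℝ 1 fun p => V i₀ p ω := by
        refine contDiff_pi.2 fun k => ?_
        rcases k with i | j
        · exact contDiff_euclidean.1 ((hω.of_le one_le_two).comp hpos) i
        · refine ContDiff.sum fun i _ => ContDiff.mul ?_ ?_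
          · by_cases h : i = i₀
            · simpa [dir, h] using contDiff_const
            · simpa [dir, h] using contDiff_apply ℝ ℝ _
          · have hd : ContDiff ℝ 1 (fderiv ℝ fun y => F y ω) := hω.fderiv_right (by norm_num)
            exact contDiff_euclidean.1 ((hd.comp hpos).clm_apply contDiff_const) i
      exact hV.locallyLipschitz.locallyLipschitzOn.exists_lipschitzOnWith_of_compact
        (isCompact_closedBall _ _)
  filter_upwards [hzero] with ω hω x hx
  rw [surjective_iff_forall_inner]
  intro u hu
  by_contra! hv
  have hne : Nonempty (Fin m) := by
    by_contra hemp
    rw [not_nonempty_iff] at hemp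
    have : u = 0 := Subsingleton.elim _ _
    simp [this] at hu
  -- Dividing by the coordinate of largest modulus puts the remaining ones in [-1, 1], so the
  -- parameter lies in the cube of half-width M as soon as M ≥ max(‖x‖, 1).
  obtain ⟨i₀, hi₀⟩ := Finite.exists_max fun i => |u i|
  have hu0 : u i₀ ≠ 0 := by
    intro h0
    have : u = 0 := by
      ext i
      have := hi₀ i
      rw [h0, abs_zero] at this
      simpa using this
    simp [this] at hu
  obtain ⟨M, hM⟩ := exists_nat_ge (max ‖x‖ 1)
  let p : Fin n ⊕ {i // i ≠ i₀} → ℝ := Sum.elim (fun j => x j) fun i => u i / u i₀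
  have hpos : pos i₀ p = x := rfl
  have hdir : ∀ i, dir i₀ p i = u i / u i₀ := by
    intro i
    by_cases h : i = i₀
    · simp [dir, h, hu0]
    · simp [dir, h, p]
  refine hω i₀ M p ?_ ?_
  · rw [mem_closedBall_zero_iff, pi_norm_le_iff_of_nonneg (by positivity)]
    rintro (j | i)
    · exact (PiLp.norm_apply_le x j).trans ((le_max_left _ _).trans hM)
    · refine le_trans ?_ ((le_max_right ‖x‖ 1).trans hM)
      simp only [p, Sum.elim_inr, Real.norm_eq_abs, abs_div]
      exact (div_le_one (abs_pos.2 hu0)).2 (hi₀ i)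
  · funext k
    rcases k with i | j
    · simp [V, hpos, hx]
    · have h1 := hv (EuclideanSpace.single j 1)
      rw [PiLp.inner_apply] at h1
      simp only [RCLike.inner_apply, conj_trivial] at h1
      simp only [V, Sum.elim_inr, hdir, hpos, partialDerivField, Pi.zero_apply,
        div_mul_eq_mul_div, ← Finset.sum_div]
      rw [div_eq_zero_iff]
      left
      rw [← h1]
      exact Finset.sum_congr rfl fun i _ => mul_comm _ _

end Bulinskaya

/-! ### Weak convergence in Hilbert space and simultaneous smallness of translates. -/

/-- Bounded weak convergence may be tested on a total family. -/
theorem tendsto_inner_of_tendsto_inner_total {H α ι : Type*} [NormedAddCommGroup H]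
    [InnerProductSpace ℂ H] [CompleteSpace H] {l : Filter α} {e : ι → H} {u : α → H} {w : H}
    {C : ℝ} (hbd : ∀ v, ‖u v‖ ≤ C)
    (hu : ∀ v, u v ∈ (Submodule.span ℂ (Set.range e)).topologicalClosure)
    (hw : w ∈ (Submodule.span ℂ (Set.range e)).topologicalClosure)
    (h : ∀ i, Tendsto (fun v => inner ℂ (e i) (u v)) l (𝓝 (inner ℂ (e i) w))) (g : H) :
    Tendsto (fun v => inner ℂ g (u v)) l (𝓝 (inner ℂ g w)) := by
  set M := (Submodule.span ℂ (Set.range e)).topologicalClosure with hM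
  have hMc : IsClosed (M : Set H) := Submodule.isClosed_topologicalClosure _
  have : CompleteSpace M := hMc.completeSpace_coe
  have hspan : ∀ x ∈ Submodule.span ℂ (Set.range e),
      Tendsto (fun v => inner ℂ x (u v - w)) l (𝓝 0) := by
    intro x hx
    induction hx using Submodule.span_induction with
    | mem x hx =>
      obtain ⟨i, rfl⟩ := hx
      simpa only [inner_sub_right] using tendsto_sub_nhds_zero_iff.2 (h i)
    | zero => simpa using tendsto_const_nhds
    | add x y _ _ hx hy => simpa only [inner_add_left, add_zero] using hx.add hy
    | smul a x _ hx => simpa only [inner_smul_left, mul_zero] using hx.const_mul (starRingEnd ℂ a)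
  have hclos : ∀ x ∈ M, Tendsto (fun v => inner ℂ x (u v - w)) l (𝓝 0) := by
    intro x hx
    rw [Metric.tendsto_nhds]
    intro ε hε
    have hK : 0 < |C| + ‖w‖ + 1 := by positivity
    obtain ⟨y, hy, hxy⟩ := Metric.mem_closure_iff.1 hx (ε / 2 / (|C| + ‖w‖ + 1)) (by positivity)
    filter_upwards [Metric.tendsto_nhds.1 (hspan y hy) (ε / 2) (by positivity)] with v hv
    rw [dist_zero_right] at hv ⊢
    have h1 : inner ℂ x (u v - w) = inner ℂ (x - y) (u v - w) + inner ℂ y (u v - w) := by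
      rw [← inner_add_left, sub_add_cancel]
    have h2 : ‖u v - w‖ ≤ |C| + ‖w‖ + 1 :=
      (norm_sub_le _ _).trans (by linarith [hbd v, le_abs_self C])
    have h3 : ‖inner ℂ (x - y) (u v - w)‖ ≤ ε / 2 := by
      refine (norm_inner_le_norm _ _).trans ?_
      rw [dist_eq_norm] at hxy
      calc ‖x - y‖ * ‖u v - w‖ ≤ ε / 2 / (|C| + ‖w‖ + 1) * (|C| + ‖w‖ + 1) := by gcongr
        _ = ε / 2 := by field_simp
    rw [h1]
    exact (norm_add_le _ _).trans_lt (by linarith)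
  rw [← tendsto_sub_nhds_zero_iff]
  -- All the vectors u v - w lie in M, so g may be replaced by its orthogonal projection onto M.
  -- Density of the span in the whole of H is not needed.
  refine (hclos _ (M.starProjection_apply_mem g)).congr fun v => ?_
  have h0 := M.starProjection_inner_eq_zero g (u v - w) (M.sub_mem (hu v) hw)
  rw [inner_sub_left, sub_eq_zero] at h0
  rw [← h0, inner_sub_right]

/-- A nonnegative function with vanishing averages over large balls is simultaneously small at
some translate of any finite set. -/
theorem exists_forall_lt_of_tendsto_average_zero {n : ℕ} {h : Euc n → ℝ} (hc : Continuous h)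
    (h0 : ∀ x, 0 ≤ h x)
    (hlim : Tendsto (fun R : ℝ => ⨍ x in Metric.ball (0 : Euc n) R, h x) atTop (𝓝 0))
    (Z : Finset (Euc n)) {ε : ℝ} (hε : 0 < ε) : ∃ v, ∀ z ∈ Z, h (z + v) < ε := by
  by_contra! hcon
  obtain ⟨ρ, hρ⟩ := Z.finite_toSet.isBounded.exists_norm_le
  have hint : ∀ x R, IntegrableOn h (Metric.ball x R) := fun x R =>
    (hc.continuousOn.integrableOn_compact (isCompact_closedBall x R)).mono_set
      Metric.ball_subset_closedBall
  -- If no translate works, the sum of h(z + v) over z in Z is at least ε for every v. Averaging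
  -- over the ball of radius R ≥ ρ, each translated ball sits in the ball of radius 2R, whose volume
  -- is 2 ^ n times larger.
  have hbound : ∀ R : ℝ, max ρ 1 ≤ R →
      ε ≤ Z.card * (2 ^ n * ⨍ x in Metric.ball (0 : Euc n) (2 * R), h x) := by
    intro R hR
    have hR1 : 1 ≤ R := (le_max_right _ _).trans hR
    have hRpos : 0 < R := by linarith
    set b := volume.real (Metric.ball (0 : Euc n) R) with hb
    have hbpos : 0 < b :=
      ENNReal.toReal_pos (Metric.measure_ball_pos _ _ hRpos).ne' measure_ball_lt_top.ne
    have hb2 : volume.real (Metric.ball (0 : Euc n) (2 * R)) = 2 ^ n * b := by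
      rw [hb, measureReal_def, Measure.addHaar_ball_mul_of_pos _ _ two_pos, measureReal_def,
        ENNReal.toReal_mul]
      simp
    have hshift : ∀ z ∈ Z, IntegrableOn (fun v => h (z + v)) (Metric.ball 0 R) ∧
        ∫ v in Metric.ball 0 R, h (z + v) ≤ ∫ x in Metric.ball (0 : Euc n) (2 * R), h x := by
      intro z hz
      constructor
      · have hcz : Continuous fun v => h (z + v) := by fun_prop
        exact (hcz.continuousOn.integrableOn_compact (isCompact_closedBall 0 R)).mono_set
          Metric.ball_subset_closedBall
      · have hpre : Metric.ball (0 : Euc n) R = (z + ·) ⁻¹' Metric.ball z R := by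
          ext v; simp
        rw [hpre, (measurePreserving_add_left volume z).setIntegral_preimage_emb
          (measurableEmbedding_addLeft z)]
        refine setIntegral_mono_set (hint _ _) (ae_of_all _ h0) (LE.le.eventuallyLE ?_)
        refine Metric.ball_subset_ball' ?_
        have := hρ z hz
        rw [dist_zero_right]
        linarith [(le_max_left ρ 1).trans hR]
    have h1 : b * ε ≤ ∫ v in Metric.ball (0 : Euc n) R, ∑ z ∈ Z, h (z + v) := by
      have : ∫ v in Metric.ball (0 : Euc n) R, ε = b * ε := by
        rw [setIntegral_const, smul_eq_mul]
      rw [← this]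
      refine integral_mono (integrableOn_const measure_ball_lt_top.ne)
        (integrable_finsetSum _ fun z hz => (hshift z hz).1) fun v => ?_
      obtain ⟨z, hz, hzv⟩ := hcon v
      exact hzv.trans (Finset.single_le_sum (f := fun z => h (z + v)) (fun _ _ => h0 _) hz)
    rw [integral_finsetSum _ fun z hz => (hshift z hz).1] at h1
    have h2 := h1.trans (Finset.sum_le_sum fun z hz => (hshift z hz).2)
    rw [Finset.sum_const, nsmul_eq_mul] at h2
    rw [setAverage_eq, hb2, smul_eq_mul]
    have h3 : (Z.card : ℝ) *
        (2 ^ n * ((2 ^ n * b)⁻¹ * ∫ x in Metric.ball (0 : Euc n) (2 * R), h x)) =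
        (Z.card * ∫ x in Metric.ball (0 : Euc n) (2 * R), h x) / b := by field_simp
    rw [h3, le_div_iff₀ hbpos]
    linarith
  have hlim2 := (((hlim.comp (tendsto_id.const_mul_atTop two_pos)).const_mul (2 ^ n)).const_mul
    (Z.card : ℝ))
  simp only [mul_zero] at hlim2
  exact absurd (ge_of_tendsto hlim2 (eventually_ge_atTop _ |>.mono hbound)) (not_le.2 hε)

/-! ### Characters on C¹_* and uniqueness of measures. -/

namespace C1Star

variable {n m : ℕ}

theorem measurable_eval (x : Euc n) : Measurable fun G : C1Star n m => G.1.1 x :=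
  (C1Space.measurable_eval x).comp measurable_subtype_coe

theorem measurable_of_eval {Z : Type*} [MeasurableSpace Z] {Φ : Z → C1Star n m}
    (h : ∀ x, Measurable fun z => (Φ z).1.1 x) : Measurable Φ :=
  (C1Space.measurable_of_eval h).subtype_mk (h := fun z => (Φ z).2)

theorem measurable_vadd (v : Euc n) : Measurable fun G : C1Star n m => v +ᵥ G :=
  measurable_of_eval fun x => measurable_eval (x + v)

theorem measurable_linEval (t : Euc n →₀ Euc m) :
    Measurable fun G : C1Star n m => linEval t G.1.1 :=
  Finset.measurable_fun_sum _ fun x _ => measurable_const.inner (measurable_eval x)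

/-- The character of `C¹_*` attached to `t`. -/
noncomputable def char (t : Euc n →₀ Euc m) (G : C1Star n m) : ℂ :=
  Complex.exp (Complex.I * (linEval t G.1.1 : ℝ))

theorem measurable_char (t : Euc n →₀ Euc m) : Measurable (char t) :=
  Complex.measurable_exp.comp ((Complex.measurable_ofReal.comp (measurable_linEval t)).const_mul _)

theorem norm_char (t : Euc n →₀ Euc m) (G : C1Star n m) : ‖char t G‖ = 1 := by
  rw [char, mul_comm, Complex.norm_exp_ofReal_mul_I]

theorem char_vadd (t : Euc n →₀ Euc m) (v : Euc n) (G : C1Star n m) :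
    char t (v +ᵥ G) = char (shiftCoeff v t) G := by
  rw [char, char, linEval_shiftCoeff]
  rfl

theorem char_zero (G : C1Star n m) : char 0 G = 1 := by
  simp [char, linEval_zero]

theorem conj_char_mul_char (s t : Euc n →₀ Euc m) (G : C1Star n m) :
    char t G * starRingEnd ℂ (char s G) = char (t + -s) G := by
  rw [char, char, char, ← Complex.exp_conj, ← Complex.exp_add, linEval_add, linEval_neg]
  congr 1
  simp only [map_mul, Complex.conj_I, Complex.conj_ofReal]
  push_cast
  ring

/-- Finite measures on `C¹_*` are determined by the integrals of the characters. -/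
theorem measure_ext_of_integral_char {μ ν : Measure (C1Star n m)} [IsFiniteMeasure μ]
    [IsFiniteMeasure ν] (h : ∀ t, ∫ G, char t G ∂μ = ∫ G, char t G ∂ν) : μ = ν := by
  classical
  let ev : C1Star n m → Euc n → Euc m := fun G => G.1.1
  have hev : Measurable ev := measurable_pi_lambda _ measurable_eval
  -- The Borel σ-algebra is generated by the evaluations: the identity from the σ-algebra they
  -- generate is measurable by `measurable_of_eval`.
  have hcomap : (inferInstance : MeasurableSpace (C1Star n m)) ≤
      MeasurableSpace.comap ev inferInstance := by
    let _ : MeasurableSpace (C1Star n m) := MeasurableSpace.comap ev inferInstance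
    have hid : @Measurable _ _ (MeasurableSpace.comap ev inferInstance)
        (Subtype.instMeasurableSpace) (id : C1Star n m → C1Star n m) :=
      measurable_of_eval fun x => (measurable_pi_apply x).comp (comap_measurable ev)
    intro s hs
    exact hid hs
  have hfin : ∀ I : Finset (Euc n), (μ.map ev).map I.restrict = (ν.map ev).map I.restrict := by
    intro I
    have hI : Measurable (I.restrict (π := fun _ : Euc n => Euc m)) :=
      Finset.measurable_restrict I
    rw [Measure.map_map hI hev, Measure.map_map hI hev]
    refine Measure.ext_of_charFunDual (funext fun L => ?_)
    -- Riesz representatives of the components of L, which make L of a restricted path equal to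
    -- `linEval t`.
    let t : Euc n →₀ Euc m := ∑ x : I, Finsupp.single x.1
      ((InnerProductSpace.toDual ℝ (Euc m)).symm
        (L.comp (ContinuousLinearMap.single ℝ (fun _ : I => Euc m) x)))
    have ht : ∀ G : C1Star n m, L (I.restrict (ev G)) = linEval t G.1.1 := by
      intro G
      simp only [t, linEval_sum, linEval_single, InnerProductSpace.toDual_symm_apply,
        ContinuousLinearMap.comp_apply]
      rw [← map_sum]
      congr 1
      exact (LinearMap.sum_single_apply (fun _ : I => Euc m) (I.restrict (ev G))).symm
    have hchar : ∀ κ : Measure (C1Star n m),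
        charFunDual (κ.map (I.restrict ∘ ev)) L = ∫ G, char t G ∂κ := by
      intro κ
      rw [charFunDual_apply, integral_map (hI.comp hev).aemeasurable (by fun_prop)]
      refine integral_congr_ae (ae_of_all _ fun G => ?_)
      simp only [Function.comp_apply, ht, char, mul_comm]
    rw [hchar, hchar, h]
  have hmap : μ.map ev = ν.map ev :=
    IsProjectiveLimit.unique (P := fun I => (ν.map ev).map I.restrict) hfin fun _ => rfl
  ext s hs
  obtain ⟨B, hB, rfl⟩ := hcomap s hs
  rw [← Measure.map_apply hev hB, ← Measure.map_apply hev hB, hmap]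

end C1Star

/-! ### Decorrelation along a filter of translations, and ergodicity. -/

section Ergodicity

variable {Ω : Type*} [MeasurableSpace Ω] {P : Measure Ω} {n m : ℕ} {F : Euc n → Ω → Euc m}

/-- The filter of translations along which all translated covariances tend to zero. -/
noncomputable def decorrelationFilter (F : Euc n → Ω → Euc m) (P : Measure Ω) : Filter (Euc n) :=
  comap (fun v (q : Euc n × Fin m × Fin m) => covFun F P q.2.1 q.2.2 (q.1 + v)) (𝓝 0)

theorem tendsto_covFun_decorrelationFilter (x : Euc n) (i j : Fin m) :
    Tendsto (fun v => covFun F P i j (x + v)) (decorrelationFilter F P) (𝓝 0) :=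
  tendsto_pi_nhds.1 (tendsto_comap (f := fun v (q : Euc n × Fin m × Fin m) =>
    covFun F P q.2.1 q.2.2 (q.1 + v)) (x := 𝓝 0)) (x, i, j)

/-- A neighbourhood of 0 in the product topology constrains only finitely many triples (x, i, j).
One translation making the sum of squared covariances less than ε² at these finitely many points
meets all the constraints. -/
theorem neBot_decorrelationFilter (hk : ∀ i j, Continuous (covFun F P i j))
    (hcov : Tendsto (fun R : ℝ => ∑ i₁ : Fin m, ∑ i₂ : Fin m,
        ⨍ x in Metric.ball (0 : Euc n) R, (covFun F P i₁ i₂ x) ^ 2) atTop (𝓝 0)) :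
    (decorrelationFilter F P).NeBot := by
  classical
  have hint : ∀ i j R, IntegrableOn (fun x => covFun F P i j x ^ 2)
      (Metric.ball (0 : Euc n) R) := fun i j R =>
    (((hk i j).pow 2).continuousOn.integrableOn_compact (isCompact_closedBall 0 R)).mono_set
      Metric.ball_subset_closedBall
  have hlim : Tendsto (fun R : ℝ => ⨍ x in Metric.ball (0 : Euc n) R,
      ∑ i₁ : Fin m, ∑ i₂ : Fin m, (covFun F P i₁ i₂ x) ^ 2) atTop (𝓝 0) := by
    refine hcov.congr fun R => ?_
    simp only [setAverage_eq]
    rw [integral_finsetSum _ fun i _ => integrable_finsetSum _ fun j _ => hint i j R,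
      Finset.smul_sum]
    refine Finset.sum_congr rfl fun i _ => ?_
    rw [integral_finsetSum _ fun j _ => hint i j R, Finset.smul_sum]
  refine comap_neBot fun s hs => ?_
  rw [nhds_pi, Filter.mem_pi] at hs
  obtain ⟨I, hI, t, ht, hts⟩ := hs
  have hε : ∀ q ∈ I, ∃ ε > 0, Metric.ball (0 : ℝ) ε ⊆ t q := fun q _ =>
    Metric.mem_nhds_iff.1 (ht q)
  obtain ⟨ε, hεpos, hεt⟩ : ∃ ε > 0, ∀ q ∈ I, Metric.ball (0 : ℝ) ε ⊆ t q := by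
    choose! e he het using hε
    rcases I.eq_empty_or_nonempty with rfl | hne
    · exact ⟨1, one_pos, fun q hq => hq.elim⟩
    · obtain ⟨q₀, hq₀, hmin⟩ := Set.exists_min_image I e hI hne
      exact ⟨e q₀, he q₀ hq₀, fun q hq => (Metric.ball_subset_ball (hmin q hq)).trans (het q hq)⟩
  obtain ⟨v, hv⟩ := exists_forall_lt_of_tendsto_average_zero
    (h := fun x => ∑ i₁ : Fin m, ∑ i₂ : Fin m, (covFun F P i₁ i₂ x) ^ 2)
    (by fun_prop) (fun x => by positivity) hlim (hI.toFinset.image Prod.fst)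
    (ε := ε ^ 2) (by positivity)
  refine ⟨v, hts fun q hq => hεt q hq ?_⟩
  have h1 := hv q.1 (Finset.mem_image_of_mem _ (hI.mem_toFinset.2 hq))
  rw [mem_ball_zero_iff, Real.norm_eq_abs]
  refine abs_lt_of_sq_lt_sq (lt_of_le_of_lt ?_ h1) hεpos.le
  refine (Finset.single_le_sum (f := fun j => covFun F P q.2.1 j (q.1 + v) ^ 2)
    (fun _ _ => sq_nonneg _) (Finset.mem_univ q.2.2)).trans ?_
  exact Finset.single_le_sum (f := fun i => ∑ j, covFun F P i j (q.1 + v) ^ 2)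
    (fun _ _ => by positivity) (Finset.mem_univ q.2.1)

/-- Along the decorrelation filter, distant functionals become uncorrelated. -/
theorem tendsto_integral_sq_linEval_shiftCoeff_add (hF : IsGaussianProcess F P)
    (hs : IsStationaryField F P) (s t : Euc n →₀ Euc m) :
    Tendsto (fun v => ∫ ω, (linEval (shiftCoeff v t + s) fun x => F x ω) ^ 2 ∂P)
      (decorrelationFilter F P)
      (𝓝 (∫ ω, (linEval t fun x => F x ω) ^ 2 ∂P + ∫ ω, (linEval s fun x => F x ω) ^ 2 ∂P)) := by
  have hB : Tendsto (fun v => s.sum fun x a => (shiftCoeff v t).sum fun y b =>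
      covForm F P a b (y - x)) (decorrelationFilter F P) (𝓝 0) := by
    simp_rw [sum_shiftCoeff_covForm, Finsupp.sum, covForm]
    rw [← Finset.sum_const_zero (s := s.support)]
    refine tendsto_finsetSum _ fun x _ => ?_
    rw [← Finset.sum_const_zero (s := t.support)]
    refine tendsto_finsetSum _ fun y _ => ?_
    rw [← Finset.sum_const_zero (s := Finset.univ (α := Fin m))]
    refine tendsto_finsetSum _ fun i _ => ?_
    rw [← Finset.sum_const_zero (s := Finset.univ (α := Fin m))]
    refine tendsto_finsetSum _ fun j _ => ?_
    simpa using (tendsto_covFun_decorrelationFilter (F := F) (P := P) (y - x) j i).const_mul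
      (s x i * t y j)
  simp_rw [add_comm (shiftCoeff _ t) s, integral_sq_linEval_add hF,
    integral_linEval_mul_linEval hF hs, integral_sq_linEval_shiftCoeff hF hs]
  have := (hB.const_mul 2).const_add
    (∫ ω, (linEval s fun x => F x ω) ^ 2 ∂P + ∫ ω, (linEval t fun x => F x ω) ^ 2 ∂P)
  rw [mul_zero, add_zero] at this
  rwa [add_comm (∫ ω, (linEval t fun x => F x ω) ^ 2 ∂P)]

/-- The law of the field on `C¹_*` pushes forward to its law on `C¹`. -/
theorem map_val_fieldLawStar (hm : AEMeasurable (samplePath F) P)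
    (hstar : ∀ᵐ ω ∂P, samplePath F ω ∈ C1Star n m) :
    (fieldLawStar F P).map Subtype.val = P.map (samplePath F) := by
  rw [fieldLawStar, (MeasurableEmbedding.subtype_coe (measurableSet_C1Star n m)).map_comap,
    Subtype.range_coe, fieldLaw]
  refine Measure.restrict_eq_self_of_ae_mem ?_
  exact (ae_map_iff hm (measurableSet_C1Star n m)).2 hstar

/-- A probability measure on `C¹_*` whose characters integrate to those of a decorrelating
Gaussian field is invariant and ergodic under shifts. -/
theorem ergodicVAdd_of_integral_char (hF : IsGaussianProcess F P) (hs : IsStationaryField F P)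
    [(decorrelationFilter F P).NeBot] {μ : Measure (C1Star n m)} [IsProbabilityMeasure μ]
    (hchar : ∀ t, ∫ G, C1Star.char t G ∂μ =
      Complex.exp ((-((∫ ω, (linEval t fun x => F x ω) ^ 2 ∂P) / 2) : ℝ))) :
    ErgodicVAdd (Euc n) (C1Star n m) μ := by
  set Q : (Euc n →₀ Euc m) → ℝ := fun t => ∫ ω, (linEval t fun x => F x ω) ^ 2 ∂P with hQ
  have hpres : ∀ v : Euc n, μ.map (v +ᵥ ·) = μ := by
    intro v
    have hp := Measure.isProbabilityMeasure_map (μ := μ)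
      (C1Star.measurable_vadd (m := m) v).aemeasurable
    refine C1Star.measure_ext_of_integral_char fun t => ?_
    rw [integral_map (C1Star.measurable_vadd v).aemeasurable
      (C1Star.measurable_char t).aestronglyMeasurable]
    simp_rw [C1Star.char_vadd]
    rw [hchar, hchar, integral_sq_linEval_shiftCoeff hF hs]
  refine
    { measure_preimage_vadd := fun v s hs => ?_
      aeconst_of_forall_preimage_vadd_ae_eq := fun {A} hA hinv => ?_ }
  · rw [← Measure.map_apply (C1Star.measurable_vadd v) hs, hpres]
  have hLp : ∀ t : Euc n →₀ Euc m, MemLp (C1Star.char t) 2 μ := fun t =>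
    MemLp.of_bound (C1Star.measurable_char t).aestronglyMeasurable 1
      (ae_of_all _ fun G => (C1Star.norm_char t G).le)
  let e : (Euc n →₀ Euc m) → Lp ℂ 2 μ := fun t => (hLp t).toLp
  have hinner : ∀ s t, inner ℂ (e s) (e t) = Complex.exp ((-(Q (t + -s) / 2) : ℝ)) := by
    intro s t
    rw [← hchar, L2.inner_def]
    refine integral_congr_ae ?_
    filter_upwards [(hLp s).coeFn_toLp, (hLp t).coeFn_toLp] with G h1 h2
    rw [h1, h2, RCLike.inner_apply, C1Star.conj_char_mul_char]
  have hAinner : ∀ t, inner ℂ (indicatorConstLp 2 hA (measure_ne_top μ A) (1 : ℂ)) (e t) =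
      ∫ G in A, C1Star.char t G ∂μ := by
    intro t
    rw [L2.inner_indicatorConstLp_one]
    exact integral_congr_ae (ae_restrict_of_ae (hLp t).coeFn_toLp)
  have hnorm : ∀ t, ‖e t‖ ≤ 1 := by
    intro t
    rw [← sq_le_one_iff₀ (norm_nonneg _), ← inner_self_eq_norm_sq (𝕜 := ℂ), hinner, add_neg_cancel]
    simp [Q, linEval_zero]
  have hmem : ∀ t, e t ∈ (Submodule.span ℂ (Set.range e)).topologicalClosure := fun t =>
    Submodule.le_topologicalClosure _ (Submodule.subset_span ⟨t, rfl⟩)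
  -- Pair the indicator of A with the shifted characters. They converge weakly to the mean times `e
  -- 0`, the constant function 1, while invariance of A and μ makes the pairing constant in the
  -- shift (`hconst`).
  have hset : ∀ t, ∫ G in A, C1Star.char t G ∂μ = μ.real A * ∫ G, C1Star.char t G ∂μ := by
    intro t
    have hweak := tendsto_inner_of_tendsto_inner_total (l := decorrelationFilter F P) (e := e)
      (u := fun v => e (shiftCoeff v t)) (w := (∫ G, C1Star.char t G ∂μ) • e 0)
      (fun v => hnorm _) (fun v => hmem _) (Submodule.smul_mem _ _ (hmem 0)) (fun s => by
        rw [inner_smul_right]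
        simp_rw [hinner, hchar]
        rw [← Complex.exp_add, ← Complex.ofReal_add]
        refine (Complex.continuous_exp.tendsto _).comp
          ((Complex.continuous_ofReal.tendsto _).comp ?_)
        have := ((tendsto_integral_sq_linEval_shiftCoeff_add hF hs (-s) t).div_const 2).neg
        rw [zero_add, ← neg_add, ← add_div]
        exact this) (indicatorConstLp 2 hA (measure_ne_top μ A) (1 : ℂ))
    have hconst : ∀ v, ∫ G in A, C1Star.char (shiftCoeff v t) G ∂μ =
        ∫ G in A, C1Star.char t G ∂μ := by
      intro v
      conv_rhs => rw [← hpres v]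
      rw [setIntegral_map hA (C1Star.measurable_char t).aestronglyMeasurable
        (C1Star.measurable_vadd v).aemeasurable, setIntegral_congr_set (hinv v)]
      simp_rw [C1Star.char_vadd]
    simp_rw [hAinner, hconst] at hweak
    rw [tendsto_nhds_unique tendsto_const_nhds hweak, inner_smul_right, hAinner, mul_comm]
    simp [C1Star.char_zero]
  -- Both finite measures integrate every character to the same value, so A is independent of every
  -- event, in particular of itself.
  have hrestrict : μ.restrict A = μ A • μ := by
    have hfin : IsFiniteMeasure (μ A • μ) := Measure.smul_finite μ (measure_ne_top μ A)
    refine C1Star.measure_ext_of_integral_char fun t => ?_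
    rw [hset, integral_smul_measure, Complex.real_smul]
    rfl
  have hsq : μ A = μ A * μ A := by
    have := congrArg (fun κ : Measure (C1Star n m) => κ A) hrestrict
    simpa [hA] using this
  rw [eventuallyConst_set']
  by_cases h0 : μ A = 0
  · exact Or.inl (ae_eq_empty.2 h0)
  · refine Or.inr ?_
    have h1 : μ A = 1 := by
      exact (ENNReal.mul_eq_left h0 (measure_ne_top μ A)).1 hsq.symm
    rw [ae_eq_univ, prob_compl_eq_zero_iff hA, h1]

end Ergodicity

theorem mainTheorem11 {Ω : Type*} [MeasurableSpace Ω] (P : Measure Ω) [IsProbabilityMeasure P]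
    (n m : ℕ) (hm : 0 < m) (hmn : m < n)
    (F : Euc n → Ω → Euc m)
    (hgauss : IsGaussianProcess F P)
    (hcentered : IsCenteredField F P)
    (hstat : IsStationaryField F P)
    (hnondeg : IsNondegenerateAtZero F P)
    (hsmooth : ∀ᵐ ω ∂P, IsC3Minus (fun x => F x ω))
    (hcov : Tendsto
      (fun R : ℝ => ∑ i₁ : Fin m, ∑ i₂ : Fin m,
        ⨍ x in Metric.ball (0 : Euc n) R, (covFun F P i₁ i₂ x) ^ 2)
      atTop (𝓝 0)) :
    IsProbabilityMeasure (fieldLawStar F P) ∧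
      ErgodicVAdd (Euc n) (C1Star n m) (fieldLawStar F P) := by
  have hC2 : ∀ᵐ ω ∂P, ContDiff ℝ 2 fun x => F x ω := hsmooth.mono fun _ h => h.1
  have hC1 : ∀ᵐ ω ∂P, ContDiff ℝ 1 fun x => F x ω := hC2.mono fun _ h => h.of_le one_le_two
  have hpath : AEMeasurable (samplePath F) P := aemeasurable_samplePath hgauss.aemeasurable hC1
  have hstar : ∀ᵐ ω ∂P, samplePath F ω ∈ C1Star n m := by
    filter_upwards [hC1, ae_forall_surjective_fderiv hgauss hcentered hstat hnondeg hC2]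
      with ω h1 h2 x hx
    have heq : (samplePath F ω).1 = fun x => F x ω := funext (samplePath_apply h1)
    rw [heq] at hx ⊢
    exact h2 x hx
  have hmap := map_val_fieldLawStar hpath hstar
  have hprob : IsProbabilityMeasure (fieldLawStar F P) := by
    have : IsProbabilityMeasure (P.map (samplePath F)) := Measure.isProbabilityMeasure_map hpath
    refine ⟨?_⟩
    rw [← Set.preimage_univ (f := Subtype.val),
      ← Measure.map_apply measurable_subtype_coe MeasurableSet.univ, hmap, measure_univ]
  have hNeBot := neBot_decorrelationFilter (continuous_covFun hgauss hcentered hstat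
    (hC1.mono fun _ h => h.continuous)) hcov
  refine ⟨hprob, ergodicVAdd_of_integral_char hgauss hstat fun t => ?_⟩
  rw [← integral_cexp_linEval hgauss hcentered]
  have hmeas : Measurable fun G : C1Space n m => Complex.exp (Complex.I * (linEval t G.1 : ℝ)) :=
    Complex.measurable_exp.comp ((Complex.measurable_ofReal.comp (Finset.measurable_fun_sum _
      fun x _ => measurable_const.inner (C1Space.measurable_eval x))).const_mul _)
  calc ∫ G, C1Star.char t G ∂(fieldLawStar F P)
      = ∫ G, Complex.exp (Complex.I * (linEval t G.1 : ℝ)) ∂(fieldLawStar F P).map Subtype.val :=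
        (integral_map measurable_subtype_coe.aemeasurable hmeas.aestronglyMeasurable).symm
    _ = ∫ ω, Complex.exp (Complex.I * (linEval t (samplePath F ω).1 : ℝ)) ∂P := by
        rw [hmap, integral_map hpath hmeas.aestronglyMeasurable]
    _ = _ := by
        refine integral_congr_ae ?_
        filter_upwards [hC1] with ω hω
        rw [show (samplePath F ω).1 = fun x => F x ω from funext (samplePath_apply hω)]
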